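/- Let $\Bbbk$ be a commutative ring with unit. A \emph{dg $\mathbb S$-module} $M$ is a family of chain complexes $M(n)$, $n\ge 0$, of $\Bbbk$-modules ($\mathbb Z$-graded, $\deg \mathrm d=-1$), each with a right $S_n$-action, written $x\mapsto x^\sigma$, commuting with $\mathrm d$; permutations are written as products of cycles and $\sigma\tau$ means "first $\tau$, then $\sigma$", so $x^{\sigma\tau}=(x^\sigma)^\tau$. It is \emph{$\mathbb S$-free} if each $M(n)_r$ is a free $\Bbbk[S_n]$-module. The composite product is $$(M\circ N)(n)=\bigoplus_{m\ge0} M(m)\otimes_{S_m}\Bigl(\bigoplus_{n_1+\dots+n_m=n}\mathrm{Ind}_{S_{n_1}\times\dots\times S_{n_m}}^{S_n}\bigl(N(n_1)\otimes\dots\otimes N(n_m)\bigr)\Bigr)$$ with the Koszul sign rule and with the differential $\mathrm d(\mu\circ(\nu_1,\dots,\nu_m))=\mathrm d\mu\circ(\nu_1,\dots,\nu_m)+\sum_i(-1)^{|\mu|+|\nu_1|+\dots+|\nu_{i-1}|}\mu\circ(\nu_1,\dots,\mathrm d\nu_i,\dots,\nu_m)$; its unit $\mathrm I$ is $\Bbbk$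 in arity $1$ and degree $0$. A \emph{dg cooperad} is a comonoid $(\mathcal C,\Delta,\varepsilon)$ for $\circ$ in dg $\mathbb S$-modules: $\Delta\colon\mathcal C\to\mathcal C\circ\mathcal C$ and $\varepsilon\colon\mathcal C\to\mathrm I$ are $\mathbb S$-equivariant chain maps of degree $0$ with $(\Delta\circ\mathrm{id})\Delta=(\mathrm{id}\circ\Delta)\Delta$ and $(\varepsilon\circ\mathrm{id})\Delta=\mathrm{id}=(\mathrm{id}\circ\varepsilon)\Delta$, modulo the canonical isomorphisms $(\mathcal C\circ\mathcal C)\circ\mathcal C\cong\mathcal C\circ(\mathcal C\circ\mathcal C)$ and $\mathrm I\circ\mathcal C\cong\mathcal C\cong\mathcal C\circ\mathrm I$. Let $LieD_{[3]}$ be the $\mathbb S$-module whose arity-$n$ part is the free $\Bbbk[S_n]$-module on the following generators (it is $0$ for $n=0$ and $n\ge6$). * $n=1$: $\lambda_1=1$ in degree $0$. * $n=2$: $\lambda_2,\ \lambda_{2;1},\ \lambda_{2;1,1},\ \lambda_{2;1,1,1}$ in degrees $1,2,3,4$. * $n=3$: $\lambda_3$ in degree $2$; $\lambda_{3;1},\lambda_{3;2}$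 in degree $3$; $\lambda_{3;1,1},\lambda_{3;1,2},\lambda_{3;2,2}$ in degree $4$. * $n=4$: $\lambda_4$ in degree $3$; $\lambda_{4;1},\lambda_{4;2},\lambda_{4;3}$ in degree $4$. * $n=5$: $\lambda_5$ in degree $4$. Let $\mathrm d$ be the $\mathbb S$-equivariant map of degree $-1$ with $\mathrm d\lambda_n=0$ for $1\le n\le5$ and $$\begin{aligned} \mathrm d\lambda_{2;1}&=-\lambda_2-\lambda_2^{(12)},\qquad \mathrm d\lambda_{2;1,1}=-\lambda_{2;1}+\lambda_{2;1}^{(12)},\qquad \mathrm d\lambda_{2;1,1,1}=-\lambda_{2;1,1}-\lambda_{2;1,1}^{(12)},\\ \mathrm d\lambda_{3;1}&=-\lambda_3-\lambda_3^{(12)},\qquad \mathrm d\lambda_{3;2}=-\lambda_3-\lambda_3^{(23)},\\ \mathrm d\lambda_{3;1,1}&=-\lambda_{3;1}+\lambda_{3;1}^{(12)},\qquad \mathrm d\lambda_{3;2,2}=-\lambda_{3;2}+\lambda_{3;2}^{(23)},\\ \mathrm d\lambda_{3;1,2}&=\lambda_{3;1}+\lambda_{3;1}^{(23)}+\lambda_{3;1}^{(132)}-\lambda_{3;2}-\lambda_{3;2}^{(12)}-\lambda_{3;2}^{(123)},\\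 \mathrm d\lambda_{4;1}&=-\lambda_4-\lambda_4^{(12)},\qquad \mathrm d\lambda_{4;2}=-\lambda_4-\lambda_4^{(23)},\qquad \mathrm d\lambda_{4;3}=-\lambda_4-\lambda_4^{(34)}. \end{aligned}$$ Let $\Delta\colon LieD_{[3]}\to LieD_{[3]}\circ LieD_{[3]}$ be the $\mathbb S$-equivariant map with $\Delta(1)=1\circ(1)$ and $\Delta(g)=1\circ(g)+\bar\Delta(g)+g\circ(1,\dots,1)$ for every other generator $g$, where $\bar\Delta$ vanishes on $\lambda_2,\lambda_{2;1},\lambda_{2;1,1},\lambda_{2;1,1,1}$, is given on $\lambda_n$, $3\le n\le 5$, as in the Koszul dual cooperad of the Leibniz operad by $$\bar\Delta(\lambda_n)=\sum_{1<j<n}\ \sum_{i_1+\dots+i_j=n}\ \sum_{\sigma}(-1)^{(j-1)(n-j)+\sum_{a}(a-1)(i_a-1)}\,\mathrm{sgn}(\sigma)\,\bigl(\lambda_j\circ(\lambda_{i_1},\dots,\lambda_{i_j})\bigr)^{\sigma}$$ (all $i_a\ge1$; $\sigma\in S_n$ such that $\sigma^{-1}$ is increasing on each of the $j$ consecutive blocks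 of lengths $i_1,\dots,i_j$ and $\sigma^{-1}(i_1)<\sigma^{-1}(i_1+i_2)<\dots<\sigma^{-1}(i_1+\dots+i_j)$), and on the other generators by $$\begin{aligned} \bar\Delta(\lambda_{3;1})&=\lambda_2\circ(\lambda_{2;1},1),\\ \bar\Delta(\lambda_{3;2})&=-\lambda_{2;1}\circ(\lambda_2,1)-\lambda_2\circ(1,\lambda_{2;1})-\lambda_{2;1}\circ(1,\lambda_2)^{(12)},\\ \bar\Delta(\lambda_{3;1,1})&=-\lambda_2\circ(\lambda_{2;1,1},1),\\ \bar\Delta(\lambda_{3;1,2})&=-\lambda_{2;1}\circ(\lambda_{2;1},1)-\lambda_{2;1}\circ(1,\lambda_{2;1})-\lambda_{2;1}\circ(1,\lambda_{2;1})^{(12)}+\lambda_{2;1,1}\circ(1,\lambda_2)^{(132)},\\ \bar\Delta(\lambda_{3;2,2})&=-\lambda_{2;1,1}\circ(\lambda_2,1)+\lambda_2\circ(1,\lambda_{2;1,1})-\lambda_{2;1,1}\circ(1,\lambda_2)^{(12)},\\ \bar\Delta(\lambda_{4;1})&=-\lambda_2\circ(\lambda_{3;1},1)-\lambda_2\circ(1,\lambda_{3;1})^{(123)}+\lambda_2\circ(\lambda_{2;1},\lambda_2)+\lambda_3\circ(\lambda_{2;1},1,1)+\lambda_{3;1}\circ(1,1,\lambda_2),\\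 \bar\Delta(\lambda_{4;2})&=-\lambda_2\circ(\lambda_{3;2},1)-\lambda_2\circ(1,\lambda_{3;1})+\lambda_2\circ(\lambda_{2;1},\lambda_2)^{(132)}+\lambda_{3;1}\circ(\lambda_2,1,1)+\lambda_{3;1}\circ(1,\lambda_2,1)^{(12)}\\ &\quad-\lambda_3\circ(1,\lambda_{2;1},1)+\lambda_{3;1}\circ(1,1,\lambda_2)^{(132)},\\ \bar\Delta(\lambda_{4;3})&=\lambda_{2;1}\circ(1,\lambda_3)^{(123)}-\lambda_2\circ(1,\lambda_{3;2})+\lambda_2\circ(1,\lambda_{3;2})^{(12)}+\lambda_{2;1}\circ(\lambda_3,1)-\lambda_2\circ(\lambda_2,\lambda_{2;1})\\ &\quad-\lambda_{2;1}\circ(\lambda_2,\lambda_2)^{(132)}+\lambda_{2;1}\circ(\lambda_2,\lambda_2)^{(23)}+\lambda_{3;2}\circ(\lambda_2,1,1)-\lambda_{3;2}\circ(1,1,\lambda_2)^{(23)}+\lambda_{3;2}\circ(1,1,\lambda_2)^{(132)}\\ &\quad+\lambda_3\circ(1,1,\lambda_{2;1})-\lambda_{3;2}\circ(1,\lambda_2,1)+\lambda_{3;2}\circ(1,\lambda_2,1)^{(12)}.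 \end{aligned}$$ (Here $\mu\circ(\nu_1,\dots,\nu_m)^\sigma$ means $(\mu\circ(\nu_1,\dots,\nu_m))^\sigma$.) Let $\varepsilon\colon LieD_{[3]}\to\mathrm I$ send $\lambda_1=1$ to $1$ and every other generator to $0$. **Lemma.** $(LieD_{[3]},\mathrm d)$ is an $\mathbb S$-free dg $\mathbb S$-module, and with the decomposition map $\Delta$ and the counit $\varepsilon$ it is a dg cooperad. -/

import Mathlib

open Equiv (Perm)

universe u

/-- The Koszul sign of reordering homogeneous symbols `x : ι` of degrees `deg x` from the order given
by `u` to the order given by `v`: a factor `(-1) ^ (deg x * deg y)` for every pair whose order is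
reversed. -/
def koszulSign {ι α β : Type*} [Fintype ι] [LinearOrder α] [LinearOrder β]
    (deg : ι → ℤ) (u : ι → α) (v : ι → β) : ℤˣ :=
  ∏ x, ∏ y, if u x < u y ∧ v y < v x then (deg x * deg y).negOnePow else 1

section KoszulSign

variable {ι α β γ : Type*} [Fintype ι] [LinearOrder α] [LinearOrder β] [LinearOrder γ]

theorem koszulSign_congr {α' β' : Type*} [LinearOrder α'] [LinearOrder β']
    (deg : ι → ℤ) (u : ι → α) (v : ι → β) (u' : ι → α') (v' : ι → β')
    (hu : ∀ x y, u x < u y ↔ u' x < u' y) (hv : ∀ x y, v x < v y ↔ v' x < v' y) :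
    koszulSign deg u v = koszulSign deg u' v' := by
  simp only [koszulSign, hu, hv]

theorem koszulSign_comp {κ : Type*} [Fintype κ] (φ : κ ≃ ι) (deg : ι → ℤ) (u : ι → α) (v : ι → β) :
    koszulSign (fun x => deg (φ x)) (fun x => u (φ x)) (fun x => v (φ x)) = koszulSign deg u v := by
  unfold koszulSign
  rw [← Equiv.prod_comp φ]
  refine Finset.prod_congr rfl fun x _ => ?_
  rw [← Equiv.prod_comp φ]

theorem koszulSign_mul (deg : ι → ℤ) (u : ι → α) (v : ι → β) (w : ι → γ)
    (hu : Function.Injective u) (hv : Function.Injective v) (hw : Function.Injective w) :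
    koszulSign deg u v * koszulSign deg v w = koszulSign deg u w := by
  have key : koszulSign deg v w = ∏ x, ∏ y,
      ((if u x < u y ∧ v x < v y ∧ w y < w x then (deg x * deg y).negOnePow else 1) *
       (if u x < u y ∧ v y < v x ∧ w x < w y then (deg x * deg y).negOnePow else 1)) := by
    simp only [Finset.prod_mul_distrib]
    rw [Finset.prod_comm (f := fun x y =>
      if u x < u y ∧ v y < v x ∧ w x < w y then (deg x * deg y).negOnePow else 1)]
    simp only [← Finset.prod_mul_distrib, koszulSign]
    refine Finset.prod_congr rfl fun x _ => Finset.prod_congr rfl fun y _ => ?_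
    by_cases hxy : x = y
    · subst hxy; simp
    · have h1 : u x ≠ u y := fun h => hxy (hu h)
      rw [mul_comm (deg y) (deg x)]
      rcases lt_or_gt_of_ne h1 with h | h
      · simp [h, h.not_gt]
      · simp [h, h.not_gt]
  rw [key]
  simp only [koszulSign, ← Finset.prod_mul_distrib]
  refine Finset.prod_congr rfl fun x _ => Finset.prod_congr rfl fun y _ => ?_
  by_cases hxy : x = y
  · subst hxy; simp
  · have h1 : u x ≠ u y := fun h => hxy (hu h)
    have h2 : v x ≠ v y := fun h => hxy (hv h)
    have h3 : w x ≠ w y := fun h => hxy (hw h)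
    rcases lt_or_gt_of_ne h1 with h | h
    · rcases lt_or_gt_of_ne h2 with h' | h' <;> rcases lt_or_gt_of_ne h3 with h'' | h'' <;>
        simp [h, h', h'', h'.not_gt, h''.not_gt, Int.units_mul_self]
    · simp [h.not_gt]

theorem koszulSign_self (deg : ι → ℤ) (u : ι → α) : koszulSign deg u u = 1 := by
  unfold koszulSign
  refine Finset.prod_eq_one fun x _ => Finset.prod_eq_one fun y _ => ?_
  rw [if_neg]
  rintro ⟨h, h'⟩
  exact lt_asymm h h'

theorem negOnePow_sum {κ : Type*} (s : Finset κ) (f : κ → ℤ) :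
    (∑ i ∈ s, f i).negOnePow = ∏ i ∈ s, (f i).negOnePow := by
  classical
  induction s using Finset.induction_on with
  | empty => simp
  | insert a s ha ih => rw [Finset.sum_insert ha, Finset.prod_insert ha, Int.negOnePow_add, ih]

/-- Permuting blocks of symbols has the Koszul sign of permuting their total degrees. -/
theorem koszulSign_blocks {l : ℕ} {T : Fin l → Type*} [∀ i, Fintype (T i)]
    (deg : (Σ i, T i) → ℤ) (h : ∀ i, T i → ℕ) (σ : Perm (Fin l)) :
    koszulSign deg (fun x => toLex (x.1, h x.1 x.2)) (fun x => toLex (σ x.1, h x.1 x.2)) =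
      koszulSign (fun i => ∑ t, deg ⟨i, t⟩) (fun i => i) (fun i => σ i) := by
  unfold koszulSign
  rw [Fintype.prod_sigma]
  refine Finset.prod_congr rfl fun i _ => ?_
  simp_rw [Fintype.prod_sigma]
  rw [Finset.prod_comm]
  refine Finset.prod_congr rfl fun j _ => ?_
  by_cases hij : i < j ∧ σ j < σ i
  · rw [if_pos hij, Finset.sum_mul_sum, negOnePow_sum]
    refine Finset.prod_congr rfl fun s _ => ?_
    rw [negOnePow_sum]
    refine Finset.prod_congr rfl fun t _ => ?_
    rw [if_pos]
    exact ⟨Prod.Lex.left _ _ hij.1, Prod.Lex.left _ _ hij.2⟩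
  · rw [if_neg hij]
    refine Finset.prod_eq_one fun s _ => Finset.prod_eq_one fun t _ => ?_
    rw [if_neg]
    rintro ⟨h1, h2⟩
    rw [Prod.Lex.toLex_lt_toLex] at h1 h2
    rcases h1 with h1 | ⟨h1, h1'⟩
    · rcases h2 with h2 | ⟨h2, h2'⟩
      · exact hij ⟨h1, h2⟩
      · exact h1.ne (σ.injective h2).symm
    · dsimp at h1 h1' h2
      subst h1
      rcases h2 with h2 | ⟨h2, h2'⟩
      · exact lt_irrefl _ h2
      · exact lt_asymm h1' h2'

/-- The Koszul sign of permuting symbols inside blocks is the product over the blocks. -/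
theorem koszulSign_inside {l : ℕ} {T : Fin l → Type*} [∀ i, Fintype (T i)]
    (deg : (Σ i, T i) → ℤ) (g h : ∀ i, T i → ℕ) :
    koszulSign deg (fun x => toLex (x.1, g x.1 x.2)) (fun x => toLex (x.1, h x.1 x.2)) =
      ∏ i, koszulSign (fun t => deg ⟨i, t⟩) (g i) (h i) := by
  unfold koszulSign
  rw [Fintype.prod_sigma]
  refine Finset.prod_congr rfl fun i _ => ?_
  refine Finset.prod_congr rfl fun s _ => ?_
  rw [Fintype.prod_sigma, Finset.prod_eq_single i]
  · refine Finset.prod_congr rfl fun t _ => ?_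
    simp [Prod.Lex.toLex_lt_toLex]
  · intro j _ hj
    refine Finset.prod_eq_one fun t _ => ?_
    rw [if_neg]
    rintro ⟨h1, h2⟩
    rw [Prod.Lex.toLex_lt_toLex] at h1 h2
    rcases h1 with h1 | ⟨h1, h1'⟩
    · rcases h2 with h2 | ⟨h2, h2'⟩
      · exact lt_asymm h1 h2
      · exact hj h2
    · exact hj h1.symm
  · simp

/-- A symbol that stays in front does not contribute to the Koszul sign. -/
theorem koszulSign_option {κ : Type*} [Fintype κ] (deg : Option κ → ℤ) (g h : Option κ → ℕ)
    (hg : g none = 0) (hh : h none = 0) :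
    koszulSign deg g h =
      koszulSign (fun t => deg (some t)) (fun t => g (some t)) (fun t => h (some t)) := by
  unfold koszulSign
  simp [Fintype.prod_option, hg, hh]

/-- How the Koszul sign changes with the degree of one symbol. -/
theorem koszulSign_update {m : ℕ} (q : Fin m → ℤ) (σ : Perm (Fin m)) (i : Fin m) :
    (∑ j ∈ Finset.univ.filter (· < i), q j).negOnePow *
        koszulSign (Function.update q i (q i - 1)) (fun j => j) (fun j => σ j) =
      koszulSign q (fun j => j) (fun j => σ j) *
        (∑ j ∈ Finset.univ.filter (· < σ i), q (σ.symm j)).negOnePow := by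
  have e1 : (∑ j ∈ Finset.univ.filter (· < σ i), q (σ.symm j)).negOnePow =
      ∏ j, if σ j < σ i then (q j).negOnePow else 1 := by
    rw [negOnePow_sum, Finset.prod_filter, ← Equiv.prod_comp σ]
    simp
  have e2 : (∑ j ∈ Finset.univ.filter (· < i), q j).negOnePow =
      ∏ j, if j < i then (q j).negOnePow else 1 := by
    rw [negOnePow_sum, Finset.prod_filter]
  have e3 : koszulSign (Function.update q i (q i - 1)) (fun j => j) (fun j => σ j) *
      koszulSign q (fun j => j) (fun j => σ j) =
      (∏ y, if i < y ∧ σ y < σ i then (q y).negOnePow else 1) *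
      (∏ x, if x < i ∧ σ i < σ x then (q x).negOnePow else 1) := by
    have a1 : (∏ y, if i < y ∧ σ y < σ i then (q y).negOnePow else 1) =
        ∏ x, ∏ y, if x = i then (if x < y ∧ σ y < σ x then (q y).negOnePow else 1) else 1 := by
      refine ((Finset.prod_eq_single i ?_ ?_).trans ?_).symm
      · intro b _ hb; simp [hb]
      · simp
      · simp
    have a2 : (∏ x, if x < i ∧ σ i < σ x then (q x).negOnePow else 1) =
        ∏ x, ∏ y, if y = i then (if x < y ∧ σ y < σ x then (q x).negOnePow else 1) else 1 := by
      refine Finset.prod_congr rfl fun x _ => ?_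
      rw [Finset.prod_eq_single i]
      · simp
      · intro b _ hb; simp [hb]
      · simp
    rw [a1, a2]
    simp only [koszulSign, ← Finset.prod_mul_distrib]
    refine Finset.prod_congr rfl fun x _ => Finset.prod_congr rfl fun y _ => ?_
    by_cases hxy : x < y ∧ σ y < σ x
    · have hne : x ≠ y := hxy.1.ne
      simp only [hxy, and_self, if_true]
      by_cases hx : x = i
      · subst hx
        simp [hne.symm]
        rw [← Int.negOnePow_add, show (q x - 1) * q y + q x * q y = 2 * (q x * q y) - q y by ring,
          Int.negOnePow_sub, Int.negOnePow_two_mul, one_mul]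
      · by_cases hy : y = i
        · subst hy
          simp [hne]
          rw [← Int.negOnePow_add, show q x * (q y - 1) + q x * q y = 2 * (q x * q y) - q x by ring,
            Int.negOnePow_sub, Int.negOnePow_two_mul, one_mul]
        · simp [hx, hy, Int.units_mul_self]
    · simp [hxy]
  have e4 : (∏ y, if i < y ∧ σ y < σ i then (q y).negOnePow else 1) *
      (∏ x, if x < i ∧ σ i < σ x then (q x).negOnePow else 1) *
      (∏ j, if j < i then (q j).negOnePow else 1) =
      ∏ j, if σ j < σ i then (q j).negOnePow else 1 := by
    simp only [← Finset.prod_mul_distrib]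
    refine Finset.prod_congr rfl fun j _ => ?_
    by_cases hj : j = i
    · subst hj; simp
    · have hs : σ j ≠ σ i := fun h => hj (σ.injective h)
      rcases lt_or_gt_of_ne hj with h | h <;> rcases lt_or_gt_of_ne hs with h' | h' <;>
        simp [h, h', h.not_gt, h'.not_gt, Int.units_mul_self]
  rw [e1, e2, ← e4, ← e3]
  calc _ = (koszulSign (Function.update q i (q i - 1)) (fun j => j) (fun j => σ j)) *
        (∏ j, if j < i then (q j).negOnePow else 1) * 1 := by rw [mul_one, mul_comm]
    _ = _ := by
      rw [← Int.units_mul_self (koszulSign q (fun j => j) (fun j => σ j))]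
      simp only [mul_comm, mul_left_comm, mul_assoc]

end KoszulSign

/-- A dg `S`-module over `k`: for every arity `n` a chain complex `X n` of `k`-modules, graded by `ℤ`
with differential of degree `-1`, with a right action `act σ x = x ^ σ` of `S_n` that commutes with
the differential. -/
structure DGSMod (k : Type u) [CommRing k] where
  X : ℕ → ℤ → Type u
  [addCommGroup : ∀ n r, AddCommGroup (X n r)]
  [module : ∀ n r, Module k (X n r)]
  act : ∀ {n : ℕ} {r : ℤ}, Perm (Fin n) → X n r →ₗ[k] X n r
  act_one : ∀ {n : ℕ} {r : ℤ} (x : X n r), act 1 x = x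
  act_mul : ∀ {n : ℕ} {r : ℤ} (σ τ : Perm (Fin n)) (x : X n r), act (σ * τ) x = act τ (act σ x)
  d : ∀ {n : ℕ} {r : ℤ}, X n r →ₗ[k] X n (r - 1)
  d_d : ∀ {n : ℕ} {r : ℤ} (x : X n r), d (d x) = 0
  d_act : ∀ {n : ℕ} {r : ℤ} (σ : Perm (Fin n)) (x : X n r), d (act σ x) = act σ (d x)

attribute [instance] DGSMod.addCommGroup DGSMod.module

namespace DGSMod

variable {k : Type u} [CommRing k]

section transport

variable (M : DGSMod k) {n : ℕ}

/-- Transport along an equality of degrees. -/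
def castTo {r s : ℤ} (h : s = r) : M.X n r →ₗ[k] M.X n s := h ▸ LinearMap.id

/-- The differential, with a target degree that is only provably `r - 1`. -/
def dTo {r s : ℤ} (h : s = r - 1) : M.X n r →ₗ[k] M.X n s := M.castTo h ∘ₗ M.d

@[simp] theorem castTo_rfl {r : ℤ} (h : r = r) (x : M.X n r) : M.castTo h x = x := rfl

theorem castTo_castTo {r s t : ℤ} (h : s = r) (h' : t = s) (x : M.X n r) :
    M.castTo h' (M.castTo h x) = M.castTo (h'.trans h) x := by
  subst h h'; rfl

theorem dTo_castTo {r s t : ℤ} (h : s = r) (h' : t = s - 1) (x : M.X n r) :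
    M.dTo h' (M.castTo h x) = M.dTo (h'.trans (by rw [h])) x := by
  subst h h'; rfl

theorem castTo_dTo {r s t : ℤ} (h : s = r - 1) (h' : t = s) (x : M.X n r) :
    M.castTo h' (M.dTo h x) = M.dTo (h'.trans h) x := by
  subst h h'; rfl

theorem dTo_dTo {r s t : ℤ} (h : s = r - 1) (h' : t = s - 1) (x : M.X n r) :
    M.dTo h' (M.dTo h x) = 0 := by
  subst h h'; exact M.d_d x

theorem castTo_act {r s : ℤ} (h : s = r) (σ : Perm (Fin n)) (x : M.X n r) :
    M.castTo h (M.act σ x) = M.act σ (M.castTo h x) := by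
  subst h; rfl

theorem dTo_act {r s : ℤ} (h : s = r - 1) (σ : Perm (Fin n)) (x : M.X n r) :
    M.dTo h (M.act σ x) = M.act σ (M.dTo h x) := by
  subst h; exact M.d_act σ x

end transport

/-- A two-level tree: a formal symbol `top ∘ (bot 0, …, bot (m - 1))` of arity `n` and degree `r`, with
`top ∈ M(m)_p` and `bot i ∈ N(ar i)_{q i}`, whose inputs are labelled by `Fin n`: the `t`-th input of
`bot i` has the label `lab ⟨i, t⟩`. With `lab` the order-preserving labelling `finSigmaFinEquiv` it is
`top ∘ (bot 0, …, bot (m - 1))` itself; with `σ⁻¹` after it, it is the result of acting by `σ`. -/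
structure Tree (M N : DGSMod k) (n : ℕ) (r : ℤ) where
  m : ℕ
  p : ℤ
  top : M.X m p
  ar : Fin m → ℕ
  q : Fin m → ℤ
  bot : ∀ i, N.X (ar i) (q i)
  lab : (Σ i, Fin (ar i)) ≃ Fin n
  deg : p + ∑ i, q i = r

open Finsupp in
/-- The relations of the composite product
`(M ∘ N)(n) = ⨁_m M(m) ⊗_{S_m} ⨁_{n_1 + ⋯ + n_m = n} Ind (N(n_1) ⊗ ⋯ ⊗ N(n_m))`, the induction being
from `S_{n_1} × ⋯ × S_{n_m}` to `S_n`: a tree is multilinear in its entries; `bot i ^ τ_i` is the same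
as a relabelling of the inputs of `bot i` (the induction); and
`μ ^ σ ∘ (ν_1, …, ν_m) = ± μ ∘ (ν_{σ⁻¹(1)}, …, ν_{σ⁻¹(m)})`, with the Koszul sign and with every input
keeping its label (the tensor product over `S_m`). -/
inductive TreeRel (M N : DGSMod k) (n : ℕ) (r : ℤ) : (Tree M N n r →₀ k) → Prop
  | top_add (m p x y ar q bot lab h) : TreeRel M N n r
      (single ⟨m, p, x + y, ar, q, bot, lab, h⟩ 1
        - (single ⟨m, p, x, ar, q, bot, lab, h⟩ 1 + single ⟨m, p, y, ar, q, bot, lab, h⟩ 1))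
  | top_smul (m p) (c : k) (x ar q bot lab h) : TreeRel M N n r
      (single ⟨m, p, c • x, ar, q, bot, lab, h⟩ 1 - c • single ⟨m, p, x, ar, q, bot, lab, h⟩ 1)
  | bot_add (m p top ar q bot i x y lab h) : TreeRel M N n r
      (single ⟨m, p, top, ar, q, Function.update bot i (x + y), lab, h⟩ 1
        - (single ⟨m, p, top, ar, q, Function.update bot i x, lab, h⟩ 1
          + single ⟨m, p, top, ar, q, Function.update bot i y, lab, h⟩ 1))
  | bot_smul (m p top ar q bot i) (c : k) (x lab h) : TreeRel M N n r
      (single ⟨m, p, top, ar, q, Function.update bot i (c • x), lab, h⟩ 1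
        - c • single ⟨m, p, top, ar, q, Function.update bot i x, lab, h⟩ 1)
  | bot_act (m p top ar q bot) (τ : ∀ i, Perm (Fin (ar i))) (lab h) : TreeRel M N n r
      (single ⟨m, p, top, ar, q, fun i => N.act (τ i) (bot i), lab, h⟩ 1
        - single ⟨m, p, top, ar, q, bot,
            (Equiv.sigmaCongrRight fun i => (τ i).symm).trans lab, h⟩ 1)
  | top_act (m p top ar q bot) (σ : Perm (Fin m)) (lab h) : TreeRel M N n r
      (single ⟨m, p, M.act σ top, ar, q, bot, lab, h⟩ 1
        - ((koszulSign q (fun i => i) (fun i => σ i) : ℤ) : k) •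
          single ⟨m, p, top, fun i => ar (σ.symm i), fun i => q (σ.symm i),
            fun i => bot (σ.symm i),
            (Equiv.sigmaCongrLeft (β := fun i => Fin (ar i)) σ.symm).trans lab,
            (by rw [← h]; exact congrArg (p + ·) (Equiv.sum_comp σ.symm q))⟩ 1)

/-- The composite product `(M ∘ N)(n)_r`: linear combinations of trees modulo the relations. -/
def CompX (M N : DGSMod k) (n : ℕ) (r : ℤ) : Type u :=
  (Tree M N n r →₀ k) ⧸ Submodule.span k {z | TreeRel M N n r z}

namespace CompX

variable {M N : DGSMod k} {n : ℕ} {r : ℤ}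

noncomputable instance : AddCommGroup (CompX M N n r) :=
  inferInstanceAs (AddCommGroup ((Tree M N n r →₀ k) ⧸ Submodule.span k {z | TreeRel M N n r z}))

noncomputable instance : Module k (CompX M N n r) :=
  inferInstanceAs (Module k ((Tree M N n r →₀ k) ⧸ Submodule.span k {z | TreeRel M N n r z}))

/-- The class of a tree. -/
noncomputable def mk (t : Tree M N n r) : CompX M N n r :=
  Submodule.Quotient.mk (Finsupp.single t 1)

theorem mk_rel {z : Tree M N n r →₀ k} (hz : TreeRel M N n r z) :
    (Submodule.Quotient.mk z : (Tree M N n r →₀ k) ⧸ Submodule.span k {z | TreeRel M N n r z}) = 0 :=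
  (Submodule.Quotient.mk_eq_zero _).2 (Submodule.subset_span hz)

/-- A function on trees that respects the relations. -/
structure Respects {A : Type*} [AddCommGroup A] [Module k A] (f : Tree M N n r → A) : Prop where
  top_add : ∀ m p x y ar q bot lab h, f ⟨m, p, x + y, ar, q, bot, lab, h⟩ =
    f ⟨m, p, x, ar, q, bot, lab, h⟩ + f ⟨m, p, y, ar, q, bot, lab, h⟩
  top_smul : ∀ m p (c : k) x ar q bot lab h, f ⟨m, p, c • x, ar, q, bot, lab, h⟩ =
    c • f ⟨m, p, x, ar, q, bot, lab, h⟩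
  bot_add : ∀ m p top ar q bot i x y lab h,
    f ⟨m, p, top, ar, q, Function.update bot i (x + y), lab, h⟩ =
      f ⟨m, p, top, ar, q, Function.update bot i x, lab, h⟩ +
      f ⟨m, p, top, ar, q, Function.update bot i y, lab, h⟩
  bot_smul : ∀ m p top ar q bot i (c : k) x lab h,
    f ⟨m, p, top, ar, q, Function.update bot i (c • x), lab, h⟩ =
      c • f ⟨m, p, top, ar, q, Function.update bot i x, lab, h⟩
  bot_act : ∀ m p top ar q bot (τ : ∀ i, Perm (Fin (ar i))) lab h,
    f ⟨m, p, top, ar, q, fun i => N.act (τ i) (bot i), lab, h⟩ =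
      f ⟨m, p, top, ar, q, bot, (Equiv.sigmaCongrRight fun i => (τ i).symm).trans lab, h⟩
  top_act : ∀ m p top ar q bot (σ : Perm (Fin m)) lab h h',
    f ⟨m, p, M.act σ top, ar, q, bot, lab, h⟩ =
      ((koszulSign q (fun i => i) (fun i => σ i) : ℤ) : k) •
        f ⟨m, p, top, fun i => ar (σ.symm i), fun i => q (σ.symm i), fun i => bot (σ.symm i),
          (Equiv.sigmaCongrLeft (β := fun i => Fin (ar i)) σ.symm).trans lab, h'⟩

theorem mk_respects : Respects (mk : Tree M N n r → CompX M N n r) where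
  top_add m p x y ar q bot lab h := sub_eq_zero.1 (mk_rel (.top_add m p x y ar q bot lab h))
  top_smul m p c x ar q bot lab h := sub_eq_zero.1 (mk_rel (.top_smul m p c x ar q bot lab h))
  bot_add m p top ar q bot i x y lab h :=
    sub_eq_zero.1 (mk_rel (.bot_add m p top ar q bot i x y lab h))
  bot_smul m p top ar q bot i c x lab h :=
    sub_eq_zero.1 (mk_rel (.bot_smul m p top ar q bot i c x lab h))
  bot_act m p top ar q bot τ lab h :=
    sub_eq_zero.1 (mk_rel (.bot_act m p top ar q bot τ lab h))
  top_act m p top ar q bot σ lab h _ :=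
    sub_eq_zero.1 (mk_rel (.top_act m p top ar q bot σ lab h))

section lift

variable {A : Type*} [AddCommGroup A] [Module k A]

/-- The universal property of the composite product. -/
noncomputable def lift (f : Tree M N n r → A) (hf : Respects f) : CompX M N n r →ₗ[k] A :=
  Submodule.liftQ _ (Finsupp.linearCombination k f) (by
    rw [Submodule.span_le]
    intro z hz
    rw [SetLike.mem_coe, LinearMap.mem_ker]
    cases hz with
    | top_add m p x y ar q bot lab h => simp [hf.top_add m p x y ar q bot lab h]
    | top_smul m p c x ar q bot lab h => simp [hf.top_smul m p c x ar q bot lab h]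
    | bot_add m p top ar q bot i x y lab h => simp [hf.bot_add m p top ar q bot i x y lab h]
    | bot_smul m p top ar q bot i c x lab h => simp [hf.bot_smul m p top ar q bot i c x lab h]
    | bot_act m p top ar q bot τ lab h => simp [hf.bot_act m p top ar q bot τ lab h]
    | top_act m p top ar q bot σ lab h =>
      rw [map_sub, map_smul, Finsupp.linearCombination_single, Finsupp.linearCombination_single,
        one_smul, one_smul, hf.top_act m p top ar q bot σ lab h
          (by rw [← h]; exact congrArg (p + ·) (Equiv.sum_comp σ.symm q)), sub_self])

@[simp] theorem lift_mk (f : Tree M N n r → A) (hf : Respects f) (t : Tree M N n r) :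
    lift f hf (mk t) = f t := by
  have : lift f hf (mk t) = Finsupp.linearCombination k f (Finsupp.single t 1) := rfl
  rw [this]; simp

theorem hom_ext {f g : CompX M N n r →ₗ[k] A} (h : ∀ t, f (mk t) = g (mk t)) : f = g := by
  refine Submodule.linearMap_qext _ (Finsupp.lhom_ext' fun t => LinearMap.ext_ring ?_)
  exact h t

theorem Respects.hom_comp {B : Type*} [AddCommGroup B] [Module k B] {f : Tree M N n r → A} (hf : Respects f)
    (φ : A →ₗ[k] B) : Respects (fun t => φ (f t)) where
  top_add m p x y ar q bot lab h := by rw [hf.top_add, map_add]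
  top_smul m p c x ar q bot lab h := by rw [hf.top_smul, map_smul]
  bot_add m p top ar q bot i x y lab h := by rw [hf.bot_add, map_add]
  bot_smul m p top ar q bot i c x lab h := by rw [hf.bot_smul, map_smul]
  bot_act m p top ar q bot τ lab h := by rw [hf.bot_act]
  top_act m p top ar q bot σ lab h h' := by rw [hf.top_act, map_smul]

end lift

/-- The class of a tree, as a multilinear function of its bottom entries. -/
noncomputable def node {m : ℕ} {p : ℤ} (top : M.X m p) {ar : Fin m → ℕ} {q : Fin m → ℤ}
    (lab : (Σ i, Fin (ar i)) ≃ Fin n) (h : p + ∑ i, q i = r) :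
    MultilinearMap k (fun i => N.X (ar i) (q i)) (CompX M N n r) where
  toFun bot := mk ⟨m, p, top, ar, q, bot, lab, h⟩
  map_update_add' := by
    intro inst bot i x y
    obtain rfl : inst = instDecidableEqFin m := Subsingleton.elim _ _
    exact mk_respects.bot_add ..
  map_update_smul' := by
    intro inst bot i c x
    obtain rfl : inst = instDecidableEqFin m := Subsingleton.elim _ _
    exact mk_respects.bot_smul ..

theorem node_apply {m : ℕ} {p : ℤ} (top : M.X m p) {ar : Fin m → ℕ} {q : Fin m → ℤ}
    (lab : (Σ i, Fin (ar i)) ≃ Fin n) (h : p + ∑ i, q i = r) (bot : ∀ i, N.X (ar i) (q i)) :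
    node top lab h bot = mk ⟨m, p, top, ar, q, bot, lab, h⟩ := rfl

/-- The right action of `S_n`: an input with label `v` gets the label `σ⁻¹ v`. -/
noncomputable def act (σ : Perm (Fin n)) : CompX M N n r →ₗ[k] CompX M N n r :=
  lift (fun t => mk { t with lab := t.lab.trans σ.symm })
    { top_add := fun _ _ _ _ _ _ _ _ _ => mk_respects.top_add ..
      top_smul := fun _ _ _ _ _ _ _ _ _ => mk_respects.top_smul ..
      bot_add := fun _ _ _ _ _ _ _ _ _ _ _ => mk_respects.bot_add ..
      bot_smul := fun _ _ _ _ _ _ _ _ _ _ _ => mk_respects.bot_smul ..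
      bot_act := fun _ _ _ _ _ _ _ _ _ => mk_respects.bot_act ..
      top_act := fun _ _ _ _ _ _ _ _ _ _ => mk_respects.top_act .. }

theorem act_mk (σ : Perm (Fin n)) (t : Tree M N n r) :
    act σ (mk t) = mk { t with lab := t.lab.trans σ.symm } := lift_mk ..

theorem act_node {m : ℕ} {p : ℤ} (top : M.X m p) {ar : Fin m → ℕ} {q : Fin m → ℤ}
    (lab : (Σ i, Fin (ar i)) ≃ Fin n) (h : p + ∑ i, q i = r) (bot : ∀ i, N.X (ar i) (q i))
    (σ : Perm (Fin n)) : act σ (node top lab h bot) = node top (lab.trans σ.symm) h bot :=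
  act_mk ..

theorem node_add {m : ℕ} {p : ℤ} (x y : M.X m p) {ar : Fin m → ℕ} {q : Fin m → ℤ}
    (lab : (Σ i, Fin (ar i)) ≃ Fin n) (h : p + ∑ i, q i = r) (bot : ∀ i, N.X (ar i) (q i)) :
    node (x + y) lab h bot = node x lab h bot + node y lab h bot := mk_respects.top_add ..

theorem node_smul {m : ℕ} {p : ℤ} (c : k) (x : M.X m p) {ar : Fin m → ℕ} {q : Fin m → ℤ}
    (lab : (Σ i, Fin (ar i)) ≃ Fin n) (h : p + ∑ i, q i = r) (bot : ∀ i, N.X (ar i) (q i)) :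
    node (c • x) lab h bot = c • node x lab h bot := mk_respects.top_smul ..

theorem node_zero {m : ℕ} {p : ℤ} {ar : Fin m → ℕ} {q : Fin m → ℤ}
    (lab : (Σ i, Fin (ar i)) ≃ Fin n) (h : p + ∑ i, q i = r) (bot : ∀ i, N.X (ar i) (q i)) :
    node (0 : M.X m p) lab h bot = 0 := by
  rw [← zero_smul k (0 : M.X m p), node_smul, zero_smul]

theorem node_bot_act {m : ℕ} {p : ℤ} (x : M.X m p) {ar : Fin m → ℕ} {q : Fin m → ℤ}
    (lab : (Σ i, Fin (ar i)) ≃ Fin n) (h : p + ∑ i, q i = r) (bot : ∀ i, N.X (ar i) (q i))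
    (τ : ∀ i, Perm (Fin (ar i))) :
    node x lab h (fun i => N.act (τ i) (bot i)) =
      node x ((Equiv.sigmaCongrRight fun i => (τ i).symm).trans lab) h bot :=
  mk_respects.bot_act ..

theorem node_top_act {m : ℕ} {p : ℤ} (x : M.X m p) {ar : Fin m → ℕ} {q : Fin m → ℤ}
    (lab : (Σ i, Fin (ar i)) ≃ Fin n) (h : p + ∑ i, q i = r) (bot : ∀ i, N.X (ar i) (q i))
    (σ : Perm (Fin m)) :
    node (M.act σ x) lab h bot = ((koszulSign q (fun i => i) (fun i => σ i) : ℤ) : k) •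
      node x (ar := fun i => ar (σ.symm i)) (q := fun i => q (σ.symm i))
        ((Equiv.sigmaCongrLeft (β := fun i => Fin (ar i)) σ.symm).trans lab)
        (by rw [← h]; exact congrArg (p + ·) (Equiv.sum_comp σ.symm q))
        (fun i => bot (σ.symm i)) :=
  mk_respects.top_act ..

/-- Trees with equal data, up to transport of degrees, agree. -/
theorem node_congr {m : ℕ} {p : ℤ} (x : M.X m p) {ar : Fin m → ℕ} {q q' : Fin m → ℤ}
    (lab : (Σ i, Fin (ar i)) ≃ Fin n) (h : p + ∑ i, q i = r) (h' : p + ∑ i, q' i = r)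
    (bot : ∀ i, N.X (ar i) (q i)) (bot' : ∀ i, N.X (ar i) (q' i)) (hq : ∀ i, q' i = q i)
    (hb : ∀ i, bot' i = N.castTo (hq i) (bot i)) :
    node x lab h bot = node x lab h' bot' := by
  obtain rfl : q' = q := funext hq
  obtain rfl : bot' = bot := funext hb
  rfl

theorem node_lab_congr {m : ℕ} {p : ℤ} (x : M.X m p) {ar : Fin m → ℕ} {q : Fin m → ℤ}
    {lab lab' : (Σ i, Fin (ar i)) ≃ Fin n} (h : p + ∑ i, q i = r) (bot : ∀ i, N.X (ar i) (q i))
    (hl : ∀ y, lab y = lab' y) : node x lab h bot = node x lab' h bot := by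
  obtain rfl : lab = lab' := Equiv.ext hl
  rfl

/-- The differential of `N` in the `i`-th place, the identity in the other places. -/
def shift (N : DGSMod k) {m : ℕ} (ar : Fin m → ℕ) (q : Fin m → ℤ) (i j : Fin m) :
    N.X (ar j) (q j) →ₗ[k] N.X (ar j) (Function.update q i (q i - 1) j) :=
  if h : j = i then N.dTo (by subst h; simp) else N.castTo (by simp [h])

theorem sum_update_sub_one {m : ℕ} (q : Fin m → ℤ) (i : Fin m) {p : ℤ} (h : p + ∑ j, q j = r) :
    p + ∑ j, Function.update q i (q i - 1) j = r - 1 := by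
  rw [Finset.sum_update_of_mem (Finset.mem_univ i), ← h,
    ← Finset.add_sum_erase Finset.univ q (Finset.mem_univ i), Finset.sdiff_singleton_eq_erase]
  ring

/-- The sign `(-1) ^ (p + q 0 + ⋯ + q (i - 1))` of moving `d` to the `i`-th place. -/
def prefixSign {m : ℕ} (p : ℤ) (q : Fin m → ℤ) (i : Fin m) : ℤˣ :=
  (p + ∑ j ∈ Finset.univ.filter (· < i), q j).negOnePow

/-- The summand `± μ ∘ (ν_1, …, d ν_i, …, ν_m)` of the differential. -/
noncomputable def dBot {m : ℕ} {p : ℤ} (top : M.X m p) {ar : Fin m → ℕ} {q : Fin m → ℤ}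
    (lab : (Σ i, Fin (ar i)) ≃ Fin n) (h : p + ∑ i, q i = r) (i : Fin m) :
    MultilinearMap k (fun i => N.X (ar i) (q i)) (CompX M N n (r - 1)) :=
  ((prefixSign p q i : ℤ) : k) •
    (node top lab (sum_update_sub_one q i h)).compLinearMap (shift N ar q i)

/-- The Leibniz rule
`d (μ ∘ (ν_1, …, ν_m)) = d μ ∘ (ν_1, …, ν_m) + ∑ i, ± μ ∘ (ν_1, …, d ν_i, …, ν_m)`. -/
noncomputable def dTree (t : Tree M N n r) : CompX M N n (r - 1) :=
  node (M.d t.top) t.lab (by have := t.deg; omega) t.bot + ∑ i, dBot t.top t.lab t.deg i t.bot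

theorem shift_act {m : ℕ} (ar : Fin m → ℕ) (q : Fin m → ℤ) (i j : Fin m) (σ : Perm (Fin (ar j)))
    (x : N.X (ar j) (q j)) : shift N ar q i j (N.act σ x) = N.act σ (shift N ar q i j x) := by
  unfold shift
  split_ifs with h
  · exact N.dTo_act _ σ x
  · exact N.castTo_act _ σ x

theorem dBot_apply {m : ℕ} {p : ℤ} (top : M.X m p) {ar : Fin m → ℕ} {q : Fin m → ℤ}
    (lab : (Σ i, Fin (ar i)) ≃ Fin n) (h : p + ∑ i, q i = r) (i : Fin m)
    (bot : ∀ i, N.X (ar i) (q i)) : dBot top lab h i bot = ((prefixSign p q i : ℤ) : k) •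
      node top lab (sum_update_sub_one q i h) (fun j => shift N ar q i j (bot j)) := rfl

theorem dTree_respects : Respects (dTree : Tree M N n r → CompX M N n (r - 1)) where
  top_add m p x y ar q bot lab h := by
    simp only [dTree, map_add, node_add, dBot_apply, smul_add, Finset.sum_add_distrib]; abel
  top_smul m p c x ar q bot lab h := by
    simp only [dTree, map_smul, node_smul, dBot_apply, smul_add, Finset.smul_sum, smul_comm c]
  bot_add m p top ar q bot i x y lab h := by
    simp only [dTree, MultilinearMap.map_update_add, Finset.sum_add_distrib]; abel
  bot_smul m p top ar q bot i c x lab h := by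
    simp only [dTree, MultilinearMap.map_update_smul, smul_add, Finset.smul_sum]
  bot_act m p top ar q bot τ lab h := by
    simp only [dTree, node_bot_act, dBot_apply, shift_act]
  top_act m p top ar q bot σ lab h h' := by
    simp only [dTree, smul_add, Finset.smul_sum, M.d_act]
    congr 1
    · rw [node_top_act]
    · rw [← Equiv.sum_comp σ (fun i => _ • dBot _ _ _ _ _)]
      refine Finset.sum_congr rfl fun i _ => ?_
      rw [dBot_apply, dBot_apply, node_top_act, smul_smul, smul_smul]
      have hs : prefixSign p q i * koszulSign (Function.update q i (q i - 1)) (fun i => i) (fun i => σ i)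
          = koszulSign q (fun i => i) (fun i => σ i) * prefixSign p (fun j => q (σ.symm j)) (σ i) := by
        unfold prefixSign
        rw [Int.negOnePow_add, Int.negOnePow_add, mul_assoc, koszulSign_update]
        exact mul_left_comm _ _ _
      rw [← Int.cast_mul, ← Int.cast_mul, ← Units.val_mul, ← Units.val_mul, hs]
      congr 1
      have hq : ∀ j, Function.update (fun j => q (σ.symm j)) (σ i) (q (σ.symm (σ i)) - 1) j =
          Function.update q i (q i - 1) (σ.symm j) := by
        intro j
        by_cases hj : σ.symm j = i
        · obtain rfl : j = σ i := by rw [← hj]; simp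
          simp
        · have : j ≠ σ i := by rintro rfl; simp at hj
          simp [hj, this]
      refine node_congr _ _ _ _ _ _ hq fun j => ?_
      unfold shift
      by_cases hj : σ.symm j = i
      · have h2 : j = σ i := by rw [← hj]; simp
        rw [dif_pos hj, dif_pos h2, castTo_dTo]
      · have h2 : j ≠ σ i := by rintro rfl; simp at hj
        rw [dif_neg hj, dif_neg h2, castTo_castTo]

/-- The differential of the composite product. -/
noncomputable def d : CompX M N n r →ₗ[k] CompX M N n (r - 1) := lift dTree dTree_respects

theorem d_mk (t : Tree M N n r) : d (mk t) = dTree t := lift_mk ..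

theorem d_node {m : ℕ} {p : ℤ} (top : M.X m p) {ar : Fin m → ℕ} {q : Fin m → ℤ}
    (lab : (Σ i, Fin (ar i)) ≃ Fin n) (h : p + ∑ i, q i = r) (bot : ∀ i, N.X (ar i) (q i)) :
    d (node top lab h bot) = node (M.d top) lab (by omega) bot + ∑ i, dBot top lab h i bot :=
  d_mk ..

theorem prefixSign_cross {m : ℕ} (p : ℤ) (q : Fin m → ℤ) {i j : Fin m} (hij : i ≠ j) :
    prefixSign p q i * prefixSign p (Function.update q i (q i - 1)) j =
      - (prefixSign p q j * prefixSign p (Function.update q j (q j - 1)) i) := by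
  wlog hlt : i < j generalizing i j
  · rw [this hij.symm (lt_of_le_of_ne (not_lt.1 hlt) hij.symm), neg_neg]
  have e1 : prefixSign p (Function.update q j (q j - 1)) i = prefixSign p q i := by
    unfold prefixSign
    congr 2
    refine Finset.sum_congr rfl fun l hl => ?_
    rw [Function.update_of_ne]
    rintro rfl
    exact lt_asymm hlt (Finset.mem_filter.1 hl).2
  have e2 : prefixSign p (Function.update q i (q i - 1)) j = - prefixSign p q j := by
    unfold prefixSign
    have hi : i ∈ Finset.univ.filter (· < j) := by simp [hlt]
    rw [Finset.sum_update_of_mem hi, ← Finset.add_sum_erase _ q hi,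
      Finset.sdiff_singleton_eq_erase, show ∀ s : ℤ, p + (q i - 1 + s) = p + (q i + s) - 1 by
        intro s; ring, Int.negOnePow_sub, Int.negOnePow_one, mul_neg_one]
  rw [e1, e2, mul_neg, mul_comm]

theorem d_d (x : CompX M N n r) : d (d x) = 0 := by
  suffices h : (d ∘ₗ d : CompX M N n r →ₗ[k] _) = 0 from LinearMap.congr_fun h x
  refine hom_ext fun t => ?_
  obtain ⟨m, p, top, ar, q, bot, lab, h⟩ := t
  rw [LinearMap.comp_apply, d_mk, dTree, map_add, d_node, M.d_d, node_zero, zero_add, map_sum]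
  simp only [dBot_apply, map_smul, d_node, smul_add, Finset.sum_add_distrib]
  rw [← add_assoc, ← Finset.sum_add_distrib]
  have h1 : ∀ i, ((prefixSign (p - 1) q i : ℤ) : k) = - ((prefixSign p q i : ℤ) : k) := by
    intro i
    have : prefixSign (p - 1) q i = - prefixSign p q i := by
      unfold prefixSign
      rw [show p - 1 + ∑ j ∈ Finset.univ.filter (· < i), q j =
        (p + ∑ j ∈ Finset.univ.filter (· < i), q j) - 1 by ring, Int.negOnePow_sub,
        Int.negOnePow_one, mul_neg_one]
    rw [this]; push_cast; rfl
  simp only [h1, neg_smul, neg_add_cancel, Finset.sum_const_zero, zero_add, Finset.smul_sum,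
    smul_smul]
  have hdiag : ∀ i, node top lab (sum_update_sub_one _ i (sum_update_sub_one q i h))
      (fun l => shift N ar _ i l (shift N ar q i l (bot l))) = 0 := by
    intro i
    refine MultilinearMap.map_coord_zero _ i ?_
    unfold shift
    rw [dif_pos rfl, dif_pos rfl, N.dTo_dTo]
  rw [← Finset.sum_product']
  refine Finset.sum_involution (fun x _ => (x.2, x.1)) ?_ ?_ (by simp) (by simp)
  · rintro ⟨i, j⟩ -
    dsimp only
    by_cases hij : i = j
    · subst hij
      rw [hdiag, smul_zero, add_zero]
    · rw [← Int.cast_mul, ← Int.cast_mul, ← Units.val_mul, ← Units.val_mul,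
        prefixSign_cross p q hij, Units.val_neg, Int.cast_neg, neg_smul, neg_add_eq_zero]
      congr 1
      refine node_congr _ _ _ _ _ _ (fun l => ?_) fun l => ?_
      · by_cases hi : l = i
        · subst hi; simp [hij]
        · by_cases hj : l = j
          · subst hj; simp [hi]
          · simp [hi, hj]
      · unfold shift
        by_cases hi : l = i
        · have hj : l ≠ j := fun h => hij (hi.symm.trans h)
          simp only [dif_pos hi, dif_neg hj, dTo_castTo, castTo_dTo]
        · by_cases hj : l = j
          · simp only [dif_pos hj, dif_neg hi, dTo_castTo, castTo_dTo]
          · simp only [dif_neg hi, dif_neg hj, castTo_castTo]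
  · rintro ⟨i, j⟩ - hne heq
    obtain rfl : j = i := (Prod.mk.injEq _ _ _ _ ▸ heq).1
    exact hne (by rw [hdiag, smul_zero])

theorem d_act (σ : Perm (Fin n)) (x : CompX M N n r) : d (act σ x) = act σ (d x) := by
  suffices h : (d ∘ₗ act σ : CompX M N n r →ₗ[k] _) = act σ ∘ₗ d from LinearMap.congr_fun h x
  refine hom_ext fun t => ?_
  obtain ⟨m, p, top, ar, q, bot, lab, h⟩ := t
  simp only [LinearMap.comp_apply, act_mk, d_mk, dTree, map_add, map_sum, dBot_apply, map_smul]
  simp only [act_node]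

theorem act_one (x : CompX M N n r) : act 1 x = x := by
  suffices h : (act 1 : CompX M N n r →ₗ[k] _) = LinearMap.id from LinearMap.congr_fun h x
  refine hom_ext fun t => ?_
  rw [act_mk]; rfl

theorem act_mul (σ τ : Perm (Fin n)) (x : CompX M N n r) : act (σ * τ) x = act τ (act σ x) := by
  suffices h : (act (σ * τ) : CompX M N n r →ₗ[k] _) = act τ ∘ₗ act σ from LinearMap.congr_fun h x
  refine hom_ext fun t => ?_
  rw [LinearMap.comp_apply, act_mk, act_mk, act_mk]; rfl

end CompX

/-- The composite product `M ∘ N` of dg `S`-modules. -/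
@[reducible] noncomputable def comp (M N : DGSMod k) : DGSMod k where
  X := CompX M N
  act := CompX.act
  act_one := CompX.act_one
  act_mul := CompX.act_mul
  d := CompX.d
  d_d := CompX.d_d
  d_act := CompX.d_act

end DGSMod

namespace DGSMod

variable {k : Type u} [CommRing k]

/-- Morphisms of graded `S`-modules, of degree `0`; commuting with `d` is not required here. -/
structure SHom (M N : DGSMod k) where
  map : ∀ {n : ℕ} {r : ℤ}, M.X n r →ₗ[k] N.X n r
  map_act : ∀ {n : ℕ} {r : ℤ} (σ : Perm (Fin n)) (x : M.X n r), map (M.act σ x) = N.act σ (map x)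

/-- The identity. -/
def SHom.id (M : DGSMod k) : SHom M M := ⟨LinearMap.id, fun _ _ => rfl⟩

namespace CompX

variable {M M' N N' : DGSMod k} {n : ℕ} {r : ℤ}

/-- The map `f ∘ g`, sending `μ ∘ (ν_1, …, ν_m)` to `f(μ) ∘ (g(ν_1), …, g(ν_m))`. -/
noncomputable def map (f : SHom M M') (g : SHom N N') : CompX M N n r →ₗ[k] CompX M' N' n r :=
  lift (fun t => node (f.map t.top) t.lab t.deg fun i => g.map (t.bot i))
    { top_add := fun m p x y ar q bot lab h => by simp only [map_add, node_add]
      top_smul := fun m p c x ar q bot lab h => by simp only [map_smul, node_smul]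
      bot_add := fun m p top ar q bot i x y lab h =>
        ((node (f.map top) lab h).compLinearMap fun i => g.map).map_update_add bot i x y
      bot_smul := fun m p top ar q bot i c x lab h =>
        ((node (f.map top) lab h).compLinearMap fun i => g.map).map_update_smul bot i c x
      bot_act := fun m p top ar q bot τ lab h => by simp only [g.map_act, node_bot_act]
      top_act := fun m p top ar q bot σ lab h h' => by simp only [f.map_act, node_top_act] }

theorem map_act (f : SHom M M') (g : SHom N N') (σ : Perm (Fin n)) (x : CompX M N n r) :
    map f g (act σ x) = act σ (map f g x) := by
  suffices h : (map f g ∘ₗ act σ : CompX M N n r →ₗ[k] CompX M' N' n r) = act σ ∘ₗ map f g from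
    LinearMap.congr_fun h x
  refine hom_ext fun t => ?_
  simp only [LinearMap.comp_apply, map, act_mk, lift_mk, act_node]

end CompX

/-- The morphism `f ∘ g : M ∘ N → M' ∘ N'` of the composite products (not the composition of maps). -/
noncomputable def SHom.comp {M M' N N' : DGSMod k} (f : SHom M M') (g : SHom N N') :
    SHom (M.comp N) (M'.comp N') where
  map := CompX.map f g
  map_act := CompX.map_act f g

/-- The unit `I`: `k` in arity `1` and degree `0`, zero elsewhere. -/
@[reducible] noncomputable def unit (k : Type u) [CommRing k] : DGSMod k where
  X n r := ↥(if n = 1 ∧ r = 0 then ⊤ else ⊥ : Submodule k k)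
  act _ := LinearMap.id
  act_one _ := rfl
  act_mul _ _ _ := rfl
  d := 0
  d_d _ := rfl
  d_act _ _ := rfl

/-- The element `1` of the unit `I`. -/
def unit.one : (unit k).X 1 0 := ⟨1, by simp⟩

open CompX in
/-- The canonical isomorphism `M ≅ I ∘ M`, `x ↦ 1 ∘ (x)`. -/
noncomputable def leftUnitorInv (M : DGSMod k) {n : ℕ} {r : ℤ} (x : M.X n r) :
    ((unit k).comp M).X n r :=
  (node (unit.one : (unit k).X 1 0) (ar := fun _ => n) (q := fun _ => r)
    (Equiv.uniqueSigma fun _ : Fin 1 => Fin n) (by simp) fun _ => x : CompX (unit k) M n r)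

open CompX in
/-- The canonical isomorphism `M ≅ M ∘ I`, `x ↦ x ∘ (1, …, 1)`. -/
noncomputable def rightUnitorInv (M : DGSMod k) {n : ℕ} {r : ℤ} (x : M.X n r) :
    (M.comp (unit k)).X n r :=
  (node x (ar := fun _ => 1) (q := fun _ => 0)
    (Equiv.sigmaUnique (Fin n) fun _ => Fin 1) (by simp) fun _ => unit.one : CompX M (unit k) n r)

/-! ### The associator

`(M ∘ N) ∘ P ≅ M ∘ (N ∘ P)`. An element `(μ ∘ (ν_1, …, ν_l)) ∘ (ρ_1, …, ρ_m)`, where the `t`-th input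
of `ν_i` is grafted to `ρ_j` with `j = e ⟨i, t⟩`, goes to `± μ ∘ (ν_1 ∘ (…), …, ν_l ∘ (…))` with the same
underlying tree and the same labels of the inputs. The sign is the Koszul sign of reordering the
symbols from `ν_1, …, ν_l, ρ_1, …, ρ_m` to `ν_1, ρ_{e ⟨1, 1⟩}, …, ν_2, ρ_{e ⟨2, 1⟩}, …`. -/

section assoc

variable {M N P : DGSMod k} {n m : ℕ} {r p : ℤ}

/-- The labels of the inputs after reassociation, when `ε i` numbers the inputs above `ν_i`: they are
such that the underlying labelled tree does not change. -/
def assocLab {l : ℕ} {b : Fin l → ℕ} {a : Fin m → ℕ} (e : (Σ i, Fin (b i)) ≃ Fin m)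
    (lab : (Σ j, Fin (a j)) ≃ Fin n) {c : Fin l → ℕ}
    (ε : ∀ i, (Σ t : Fin (b i), Fin (a (e ⟨i, t⟩))) ≃ Fin (c i)) : (Σ i, Fin (c i)) ≃ Fin n :=
  (Equiv.sigmaCongrRight fun i => (ε i).symm).trans <|
    (Equiv.sigmaAssoc fun i t => Fin (a (e ⟨i, t⟩))).symm.trans <|
      (Equiv.sigmaCongrLeft (β := fun j => Fin (a j)) e).trans lab

theorem assocLab_apply {l : ℕ} {b : Fin l → ℕ} {a : Fin m → ℕ} (e : (Σ i, Fin (b i)) ≃ Fin m)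
    (lab : (Σ j, Fin (a j)) ≃ Fin n) {c : Fin l → ℕ}
    (ε : ∀ i, (Σ t : Fin (b i), Fin (a (e ⟨i, t⟩))) ≃ Fin (c i)) (i : Fin l) (t : Fin (b i))
    (y : Fin (a (e ⟨i, t⟩))) : assocLab e lab ε ⟨i, ε i ⟨t, y⟩⟩ = lab ⟨e ⟨i, t⟩, y⟩ := by
  have : (Equiv.sigmaCongrRight fun i => (ε i).symm) ⟨i, ε i ⟨t, y⟩⟩ = ⟨i, ⟨t, y⟩⟩ := by simp
  rw [assocLab, Equiv.trans_apply, this]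
  rfl

/-- The degrees of the symbols: `⟨i, none⟩` is `ν_i` and `⟨i, some t⟩` is `ρ_{e ⟨i, t⟩}`. -/
def assocDeg {l : ℕ} {b : Fin l → ℕ} (e : (Σ i, Fin (b i)) ≃ Fin m) (w : Fin l → ℤ)
    (q : Fin m → ℤ) : (Σ i, Option (Fin (b i))) → ℤ
  | ⟨i, none⟩ => w i
  | ⟨i, some t⟩ => q (e ⟨i, t⟩)

/-- The order of the symbols before reassociation. -/
def assocBefore {l : ℕ} {b : Fin l → ℕ} (e : (Σ i, Fin (b i)) ≃ Fin m) :
    (Σ i, Option (Fin (b i))) → ℕ ×ₗ ℕ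
  | ⟨i, none⟩ => toLex (0, (i : ℕ))
  | ⟨i, some t⟩ => toLex (1, (e ⟨i, t⟩ : ℕ))

/-- The position of a symbol in its block. -/
def slot {b : ℕ} : Option (Fin b) → ℕ
  | none => 0
  | some t => (t : ℕ) + 1

/-- The order of the symbols after reassociation. -/
def assocAfter {l : ℕ} {b : Fin l → ℕ} (x : Σ i, Option (Fin (b i))) : Fin l ×ₗ ℕ :=
  toLex (x.1, slot x.2)

/-- The Koszul sign of the reassociation. -/
def assocSign {l : ℕ} {b : Fin l → ℕ} (e : (Σ i, Fin (b i)) ≃ Fin m) (w : Fin l → ℤ)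
    (q : Fin m → ℤ) : ℤˣ :=
  koszulSign (assocDeg e w q) (assocBefore e) assocAfter

theorem assoc_deg {l : ℕ} {b : Fin l → ℕ} (e : (Σ i, Fin (b i)) ≃ Fin m) (w : Fin l → ℤ)
    (q : Fin m → ℤ) {p' : ℤ} (h' : p' + ∑ i, w i = p) (h : p + ∑ j, q j = r) :
    p' + ∑ i, (w i + ∑ t, q (e ⟨i, t⟩)) = r := by
  rw [Finset.sum_add_distrib, ← Fintype.sum_sigma' (fun i t => q (e ⟨i, t⟩)), ← add_assoc, h', ← h]
  exact congrArg (p + ·) (Equiv.sum_comp e q)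

open CompX

/-- The reassociated tree `μ ∘ (ν_1 ∘ (ρ, …), …, ν_l ∘ (…, ρ))`, without the sign. -/
noncomputable def assocNode (s : Tree M N m p) {a : Fin m → ℕ} {q : Fin m → ℤ}
    (lab : (Σ j, Fin (a j)) ≃ Fin n) (h : p + ∑ j, q j = r) {c : Fin s.m → ℕ}
    (ε : ∀ i, (Σ t : Fin (s.ar i), Fin (a (s.lab ⟨i, t⟩))) ≃ Fin (c i))
    (ρ : ∀ j, P.X (a j) (q j)) : CompX M (N.comp P) n r :=
  node (N := N.comp P) s.top (assocLab s.lab lab ε) (assoc_deg s.lab s.q q s.deg h) fun i =>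
    (node (s.bot i) (ε i) rfl fun t => ρ (s.lab ⟨i, t⟩) : CompX N P (c i) _)

theorem assocNode_indep (s : Tree M N m p) {a : Fin m → ℕ} {q : Fin m → ℤ}
    (lab : (Σ j, Fin (a j)) ≃ Fin n) (h : p + ∑ j, q j = r) {c c' : Fin s.m → ℕ}
    (ε : ∀ i, (Σ t : Fin (s.ar i), Fin (a (s.lab ⟨i, t⟩))) ≃ Fin (c i))
    (ε' : ∀ i, (Σ t : Fin (s.ar i), Fin (a (s.lab ⟨i, t⟩))) ≃ Fin (c' i))
    (ρ : ∀ j, P.X (a j) (q j)) : assocNode s lab h ε ρ = assocNode s lab h ε' ρ := by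
  obtain rfl : c = c' := funext fun i => by
    simpa using Fintype.card_congr ((ε i).symm.trans (ε' i))
  have key : ∀ i, (node (s.bot i) (ε i) rfl fun t => ρ (s.lab ⟨i, t⟩) : CompX N P (c i) _) =
      (N.comp P).act ((ε i).symm.trans (ε' i))
        (node (s.bot i) (ε' i) rfl fun t => ρ (s.lab ⟨i, t⟩) : CompX N P (c i) _) := by
    intro i
    refine Eq.trans ?_ (act_node (s.bot i) (ε' i) rfl _ _).symm
    exact node_lab_congr _ _ _ fun y => by simp
  unfold assocNode
  simp_rw [key]
  rw [node_bot_act]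
  exact node_lab_congr _ _ _ fun y => by simp [assocLab]

/-- The reassociated tree with its sign, the inputs above `ν_i` being numbered in order. -/
noncomputable def assocTree {a : Fin m → ℕ} {q : Fin m → ℤ}
    (lab : (Σ j, Fin (a j)) ≃ Fin n) (h : p + ∑ j, q j = r) (ρ : ∀ j, P.X (a j) (q j))
    (s : Tree M N m p) : CompX M (N.comp P) n r :=
  ((assocSign s.lab s.q q : ℤ) : k) • assocNode s lab h (fun _ => finSigmaFinEquiv) ρ

theorem assocBefore_injective {l : ℕ} {b : Fin l → ℕ} (e : (Σ i, Fin (b i)) ≃ Fin m) :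
    Function.Injective (assocBefore e) := by
  rintro ⟨i, _ | t⟩ ⟨j, _ | s⟩ h
  · have := congrArg (fun z => (ofLex z).2) h
    simp only [assocBefore, ofLex_toLex] at this
    rw [Fin.ext this]
  · have := congrArg (fun z => (ofLex z).1) h
    simp [assocBefore] at this
  · have := congrArg (fun z => (ofLex z).1) h
    simp [assocBefore] at this
  · have := congrArg (fun z => (ofLex z).2) h
    simp only [assocBefore, ofLex_toLex] at this
    have := e.injective (Fin.ext this)
    rw [Sigma.mk.injEq] at this
    obtain ⟨rfl, h2⟩ := this
    rw [eq_of_heq h2]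

theorem slot_injective {b : ℕ} : Function.Injective (slot (b := b)) := by
  rintro (_ | t) (_ | s) h <;> simp [slot] at h ⊢
  exact Fin.ext h

theorem assocAfter_injective {l : ℕ} {b : Fin l → ℕ} :
    Function.Injective (assocAfter (b := b)) := by
  rintro ⟨i, x⟩ ⟨j, y⟩ h
  have h1 := congrArg (fun z => (ofLex z).1) h
  have h2 := congrArg (fun z => (ofLex z).2) h
  simp only [assocAfter, ofLex_toLex] at h1 h2
  subst h1
  rw [slot_injective h2]

/-- The sign when the inputs of the middle level are permuted. -/
theorem assocSign_bot_act {l : ℕ} {b : Fin l → ℕ} (e : (Σ i, Fin (b i)) ≃ Fin m) (w : Fin l → ℤ)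
    (q : Fin m → ℤ) (τ : ∀ i, Perm (Fin (b i))) :
    assocSign e w q * ∏ i, koszulSign (fun t => q (e ⟨i, t⟩)) (fun t => t) (fun t => τ i t) =
      assocSign ((Equiv.sigmaCongrRight fun i => (τ i).symm).trans e) w q := by
  have hφ := koszulSign_comp (Equiv.sigmaCongrRight fun i => Equiv.optionCongr (τ i))
    (assocDeg ((Equiv.sigmaCongrRight fun i => (τ i).symm).trans e) w q)
    (assocBefore ((Equiv.sigmaCongrRight fun i => (τ i).symm).trans e)) assocAfter
  have h1 : (fun x => assocDeg ((Equiv.sigmaCongrRight fun i => (τ i).symm).trans e) w q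
      ((Equiv.sigmaCongrRight fun i => Equiv.optionCongr (τ i)) x)) = assocDeg e w q := by
    funext ⟨i, x⟩
    cases x <;> simp [assocDeg]
  have h2 : (fun x => assocBefore ((Equiv.sigmaCongrRight fun i => (τ i).symm).trans e)
      ((Equiv.sigmaCongrRight fun i => Equiv.optionCongr (τ i)) x)) = assocBefore e := by
    funext ⟨i, x⟩
    cases x <;> simp [assocBefore]
  rw [h1, h2] at hφ
  rw [assocSign, assocSign, ← hφ, ← koszulSign_mul _ _ assocAfter
    (fun x => assocAfter ((Equiv.sigmaCongrRight fun i => Equiv.optionCongr (τ i)) x))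
    (assocBefore_injective e) assocAfter_injective
    (assocAfter_injective.comp (Equiv.injective _))]
  congr 1
  refine Eq.trans ?_ (koszulSign_inside (assocDeg e w q) (fun i x => slot x)
    (fun i x => slot ((τ i).optionCongr x))).symm
  refine Finset.prod_congr rfl fun i _ => ?_
  rw [koszulSign_option _ _ _ rfl rfl]
  refine koszulSign_congr _ _ _ _ _ ?_ ?_ <;> intro x y <;> simp [slot]

theorem koszulSign_before {l : ℕ} {b : Fin l → ℕ} (D : (Σ i, Option (Fin (b i))) → ℤ)
    (u u' : (Σ i, Option (Fin (b i))) → ℕ ×ₗ ℕ) (g g' : Fin l → ℕ) (f f' : (Σ i, Fin (b i)) → ℕ)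
    (h1 : ∀ i, u ⟨i, none⟩ = toLex (0, g i)) (h2 : ∀ i t, u ⟨i, some t⟩ = toLex (1, f ⟨i, t⟩))
    (h1' : ∀ i, u' ⟨i, none⟩ = toLex (0, g' i))
    (h2' : ∀ i t, u' ⟨i, some t⟩ = toLex (1, f' ⟨i, t⟩)) :
    koszulSign D u u' = koszulSign (fun i => D ⟨i, none⟩) g g' *
      koszulSign (fun x : Σ i, Fin (b i) => D ⟨x.1, some x.2⟩) f f' := by
  unfold koszulSign
  simp only [Fintype.prod_sigma, Fintype.prod_option, Finset.prod_mul_distrib, h1, h2, h1', h2',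
    Prod.Lex.toLex_lt_toLex]
  simp

/-- The sign when the inputs of the top level are permuted. -/
theorem assocSign_top_act {l : ℕ} {b : Fin l → ℕ} (e : (Σ i, Fin (b i)) ≃ Fin m) (w : Fin l → ℤ)
    (q : Fin m → ℤ) (σ : Perm (Fin l)) :
    assocSign e w q * koszulSign (fun i => w i + ∑ t, q (e ⟨i, t⟩)) (fun i => i) (fun i => σ i) =
      koszulSign w (fun i => i) (fun i => σ i) *
        assocSign ((Equiv.sigmaCongrLeft (β := fun i => Fin (b i)) σ.symm).trans e)
          (fun i => w (σ.symm i)) q := by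
  let u' : (Σ i, Option (Fin (b i))) → ℕ ×ₗ ℕ := fun x => match x with
    | ⟨i, none⟩ => toLex (0, (σ i : ℕ))
    | ⟨i, some t⟩ => toLex (1, (e ⟨i, t⟩ : ℕ))
  let v' : (Σ i, Option (Fin (b i))) → Fin l ×ₗ ℕ := fun x => toLex (σ x.1, slot x.2)
  have hu' : Function.Injective u' := by
    have : u' = fun x => assocBefore ((Equiv.sigmaCongrLeft (β := fun i => Fin (b i)) σ.symm).trans e)
        ((Equiv.sigmaCongrLeft (β := fun i => Option (Fin (b i))) σ.symm).symm x) := by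
      funext x
      obtain ⟨x, rfl⟩ := (Equiv.sigmaCongrLeft (β := fun i => Option (Fin (b i))) σ.symm).surjective x
      rw [Equiv.symm_apply_apply]
      obtain ⟨i, _ | t⟩ := x <;> simp [u', assocBefore, Equiv.sigmaCongrLeft]
    rw [this]
    exact (assocBefore_injective _).comp (Equiv.injective _)
  have hv' : Function.Injective v' := by
    rintro ⟨i, x⟩ ⟨j, y⟩ h
    have h1 := congrArg (fun z => (ofLex z).1) h
    have h2 := congrArg (fun z => (ofLex z).2) h
    simp only [v', ofLex_toLex, EmbeddingLike.apply_eq_iff_eq] at h1 h2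
    subst h1
    rw [slot_injective h2]
  have key : assocSign ((Equiv.sigmaCongrLeft (β := fun i => Fin (b i)) σ.symm).trans e)
      (fun i => w (σ.symm i)) q = koszulSign (assocDeg e w q) u' v' := by
    rw [← koszulSign_comp (Equiv.sigmaCongrLeft (β := fun i => Option (Fin (b i))) σ.symm)]
    unfold assocSign
    congr 1
    · funext ⟨i, x⟩
      cases x <;> rfl
    · funext ⟨i, x⟩
      cases x <;> simp [u', assocBefore, Equiv.sigmaCongrLeft]
    · funext ⟨i, x⟩
      simp [v', assocAfter, Equiv.sigmaCongrLeft]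
  have e1 : koszulSign (assocDeg e w q) (assocBefore e) u' =
      koszulSign w (fun i => i) (fun i => σ i) := by
    rw [koszulSign_before _ _ _ (fun i => (i : ℕ)) (fun i => (σ i : ℕ)) (fun x => (e x : ℕ))
      (fun x => (e x : ℕ)) (fun _ => rfl) (fun _ _ => rfl) (fun _ => rfl) (fun _ _ => rfl),
      koszulSign_self, mul_one]
    rfl
  have e2 : koszulSign (assocDeg e w q) assocAfter v' =
      koszulSign (fun i => w i + ∑ t, q (e ⟨i, t⟩)) (fun i => i) (fun i => σ i) := by
    refine (koszulSign_blocks (assocDeg e w q) (fun _ x => slot x) σ).trans ?_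
    simp only [Fintype.sum_option]
    rfl
  rw [key, ← e1, ← e2, assocSign, koszulSign_mul _ _ _ _ (assocBefore_injective e)
    assocAfter_injective hv', koszulSign_mul _ _ _ _ (assocBefore_injective e) hu' hv']

/-- The sign when the bottom level is permuted. -/
theorem assocSign_outer {l : ℕ} {b : Fin l → ℕ} (e : (Σ i, Fin (b i)) ≃ Fin m) (w : Fin l → ℤ)
    (q : Fin m → ℤ) (σ : Perm (Fin m)) :
    assocSign (e.trans σ.symm) w q =
      koszulSign q (fun i => i) (fun i => σ i) * assocSign e w (fun j => q (σ.symm j)) := by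
  have hD : assocDeg (e.trans σ.symm) w q = assocDeg e w (fun j => q (σ.symm j)) := by
    funext ⟨i, x⟩
    cases x <;> rfl
  have e1 : koszulSign (assocDeg e w (fun j => q (σ.symm j))) (assocBefore (e.trans σ.symm))
      (assocBefore e) = koszulSign q (fun i => i) (fun i => σ i) := by
    rw [koszulSign_before _ _ _ (fun i => (i : ℕ)) (fun i => (i : ℕ))
      (fun x => ((e.trans σ.symm) x : ℕ)) (fun x => (e x : ℕ)) (fun _ => rfl) (fun _ _ => rfl)
      (fun _ => rfl) (fun _ _ => rfl), koszulSign_self, one_mul,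
      ← koszulSign_comp (e.trans σ.symm) q]
    refine koszulSign_congr _ _ _ _ _ (fun _ _ => Iff.rfl) fun x y => ?_
    simp
  rw [← e1, assocSign, assocSign, hD, koszulSign_mul _ _ _ _ (assocBefore_injective _)
    (assocBefore_injective _) assocAfter_injective]

theorem castTo_node {l : ℕ} {p' : ℤ} (x : M.X l p') {ar : Fin l → ℕ} {q : Fin l → ℤ} {r' : ℤ}
    (lab : (Σ i, Fin (ar i)) ≃ Fin n) (h : p' + ∑ i, q i = r) (bot : ∀ i, N.X (ar i) (q i))
    (hr : r' = r) : (M.comp N).castTo hr (node x lab h bot : CompX M N n r) =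
      (node x lab (h.trans hr.symm) bot : CompX M N n r') := by
  subst hr; rfl

theorem assocTree_respects {a : Fin m → ℕ} {q : Fin m → ℤ}
    (lab : (Σ j, Fin (a j)) ≃ Fin n) (h : p + ∑ j, q j = r) (ρ : ∀ j, P.X (a j) (q j)) :
    Respects (assocTree lab h ρ : Tree M N m p → CompX M (N.comp P) n r) where
  top_add l p' x y b w ν e h' := by simp only [assocTree, assocNode, node_add, smul_add]
  top_smul l p' c x b w ν e h' := by simp only [assocTree, assocNode, node_smul, smul_comm c]
  bot_add l p' μ b w ν i x y e h' := by
    have hupd : ∀ z, (fun j => (node (Function.update ν i z j) finSigmaFinEquiv rfl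
        fun t => ρ (e ⟨j, t⟩) : CompX N P _ _)) =
        Function.update (fun j => (node (ν j) finSigmaFinEquiv rfl
          fun t => ρ (e ⟨j, t⟩) : CompX N P _ _)) i
          (node z finSigmaFinEquiv rfl fun t => ρ (e ⟨i, t⟩)) := by
      intro z
      funext j
      by_cases hj : j = i
      · subst hj; simp
      · simp [hj]
    simp only [assocTree, assocNode, hupd, node_add, MultilinearMap.map_update_add, smul_add]
  bot_smul l p' μ b w ν i c x e h' := by
    have hupd : ∀ z, (fun j => (node (Function.update ν i z j) finSigmaFinEquiv rfl
        fun t => ρ (e ⟨j, t⟩) : CompX N P _ _)) =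
        Function.update (fun j => (node (ν j) finSigmaFinEquiv rfl
          fun t => ρ (e ⟨j, t⟩) : CompX N P _ _)) i
          (node z finSigmaFinEquiv rfl fun t => ρ (e ⟨i, t⟩)) := by
      intro z
      funext j
      by_cases hj : j = i
      · subst hj; simp
      · simp [hj]
    simp only [assocTree, assocNode, hupd, node_smul, MultilinearMap.map_update_smul, smul_comm c]
  bot_act l p' μ b w ν τ e h' := by
    unfold assocTree
    rw [assocNode_indep ⟨l, p', μ, b, w, ν, (Equiv.sigmaCongrRight fun i => (τ i).symm).trans e, h'⟩
      lab h (fun _ => finSigmaFinEquiv) (fun i =>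
        (Equiv.sigmaCongrLeft (β := fun t => Fin (a (e ⟨i, t⟩))) (τ i).symm).trans finSigmaFinEquiv)]
    unfold assocNode
    simp only [node_top_act]
    rw [MultilinearMap.map_smul_univ, smul_smul, ← assocSign_bot_act]
    push_cast
    congr 1
    have hq : ∀ i, w i + ∑ t, q (e ⟨i, (τ i).symm t⟩) = w i + ∑ t, q (e ⟨i, t⟩) := fun i =>
      congrArg (w i + ·) (Equiv.sum_comp (τ i).symm fun t => q (e ⟨i, t⟩))
    refine Eq.trans (node_lab_congr _ _ _ ?_) (node_congr _ _ _ _ _ _ hq fun i =>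
      (castTo_node _ _ _ _ (hq i)).symm)
    rintro ⟨i, y⟩
    obtain ⟨⟨t, y⟩, rfl⟩ := ((Equiv.sigmaCongrLeft (β := fun t => Fin (a (e ⟨i, t⟩)))
      (τ i).symm).trans finSigmaFinEquiv).surjective y
    exact (assocLab_apply e lab (fun _ => finSigmaFinEquiv) i ((τ i).symm t) y).trans
      (assocLab_apply ((Equiv.sigmaCongrRight fun i => (τ i).symm).trans e) lab (fun i =>
        (Equiv.sigmaCongrLeft (β := fun t => Fin (a (e ⟨i, t⟩))) (τ i).symm).trans
          finSigmaFinEquiv) i t y).symm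
  top_act l p' μ b w ν σ e h' h'' := by
    simp only [assocTree, assocNode, node_top_act, smul_smul]
    rw [← Int.cast_mul, ← Int.cast_mul, ← Units.val_mul, ← Units.val_mul, assocSign_top_act]
    congr 1
    refine node_lab_congr _ _ _ ?_
    rintro ⟨i, x⟩
    rfl

/-- The associator as a function of the lower composite `μ ∘ (ν_1, …, ν_l)`. -/
noncomputable def assocInner {a : Fin m → ℕ} {q : Fin m → ℤ}
    (lab : (Σ j, Fin (a j)) ≃ Fin n) (h : p + ∑ j, q j = r) (ρ : ∀ j, P.X (a j) (q j)) :
    CompX M N m p →ₗ[k] CompX M (N.comp P) n r :=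
  lift (assocTree lab h ρ) (assocTree_respects lab h ρ)

theorem assocNode_update (s : Tree M N m p) {a : Fin m → ℕ} {q : Fin m → ℤ}
    (lab : (Σ j, Fin (a j)) ≃ Fin n) (h : p + ∑ j, q j = r) {c : Fin s.m → ℕ}
    (ε : ∀ i, (Σ t : Fin (s.ar i), Fin (a (s.lab ⟨i, t⟩))) ≃ Fin (c i))
    (ρ : ∀ j, P.X (a j) (q j)) (i : Fin s.m) (t : Fin (s.ar i))
    (z : P.X (a (s.lab ⟨i, t⟩)) (q (s.lab ⟨i, t⟩))) :
    assocNode s lab h ε (Function.update ρ (s.lab ⟨i, t⟩) z) =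
      node (N := N.comp P) s.top (assocLab s.lab lab ε) (assoc_deg s.lab s.q q s.deg h)
        (Function.update (fun i =>
          (node (s.bot i) (ε i) rfl fun t => ρ (s.lab ⟨i, t⟩) : CompX N P (c i) _)) i
          (node (s.bot i) (ε i) rfl (Function.update (fun t => ρ (s.lab ⟨i, t⟩)) t z))) := by
  unfold assocNode
  congr 1
  funext i'
  by_cases hi : i' = i
  · subst hi
    rw [Function.update_self]
    congr 1
    funext t'
    by_cases ht : t' = t
    · subst ht; simp
    · simp [ht]
  · rw [Function.update_of_ne hi]
    congr 1
    funext t'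
    rw [Function.update_of_ne]
    intro h
    exact hi (congrArg Sigma.fst (s.lab.injective h))

theorem assocInner_respects : Respects (fun t : Tree (M.comp N) P n r =>
    (assocInner t.lab t.deg t.bot t.top : CompX M (N.comp P) n r)) where
  top_add m p x y a q ρ lab h := map_add _ _ _
  top_smul m p c x a q ρ lab h := map_smul _ _ _
  bot_add m p x a q ρ j y z lab h := by
    suffices H : (assocInner lab h (Function.update ρ j (y + z)) : CompX M N m p →ₗ[k] _) =
        assocInner lab h (Function.update ρ j y) + assocInner lab h (Function.update ρ j z) from
      LinearMap.congr_fun H x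
    refine hom_ext fun s => ?_
    rw [LinearMap.add_apply]
    simp only [assocInner, lift_mk, assocTree]
    obtain ⟨⟨i, t⟩, rfl⟩ := s.lab.surjective j
    simp only [assocNode_update, MultilinearMap.map_update_add, smul_add]
  bot_smul m p x a q ρ j c y lab h := by
    suffices H : (assocInner lab h (Function.update ρ j (c • y)) : CompX M N m p →ₗ[k] _) =
        c • assocInner lab h (Function.update ρ j y) from
      LinearMap.congr_fun H x
    refine hom_ext fun s => ?_
    rw [LinearMap.smul_apply]
    simp only [assocInner, lift_mk, assocTree]
    obtain ⟨⟨i, t⟩, rfl⟩ := s.lab.surjective j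
    simp only [assocNode_update, MultilinearMap.map_update_smul, smul_comm c]
  bot_act m p x a q ρ τ lab h := by
    suffices H : (assocInner lab h (fun j => P.act (τ j) (ρ j)) : CompX M N m p →ₗ[k] _) =
        assocInner ((Equiv.sigmaCongrRight fun i => (τ i).symm).trans lab) h ρ from
      LinearMap.congr_fun H x
    refine hom_ext fun s => ?_
    simp only [assocInner, lift_mk, assocTree]
    congr 1
    rw [assocNode_indep s ((Equiv.sigmaCongrRight fun i => (τ i).symm).trans lab) h _
      (fun i => (Equiv.sigmaCongrRight fun t => (τ (s.lab ⟨i, t⟩)).symm).trans finSigmaFinEquiv)]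
    unfold assocNode
    simp only [node_bot_act]
    refine node_lab_congr _ _ _ ?_
    rintro ⟨i, y⟩
    obtain ⟨⟨t, y⟩, rfl⟩ := finSigmaFinEquiv.surjective y
    have hassoc : ∀ y, (Equiv.sigmaAssoc fun i t => Fin (a (s.lab ⟨i, t⟩))).symm ⟨i, ⟨t, y⟩⟩ =
      ⟨⟨i, t⟩, y⟩ := fun _ => rfl
    simp [assocLab, Equiv.sigmaCongrLeft, hassoc]
  top_act m p x a q ρ σ lab h h' := by
    suffices H : (assocInner lab h ρ : CompX M N m p →ₗ[k] _) ∘ₗ CompX.act σ =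
        ((koszulSign q (fun i => i) (fun i => σ i) : ℤ) : k) •
        assocInner ((Equiv.sigmaCongrLeft (β := fun i => Fin (a i)) σ.symm).trans lab) h'
          (fun j => ρ (σ.symm j)) from
      LinearMap.congr_fun H x
    refine hom_ext fun s => ?_
    rw [LinearMap.comp_apply, LinearMap.smul_apply, act_mk]
    simp only [assocInner, lift_mk, assocTree, assocSign_outer, smul_smul]
    push_cast
    congr 1
    refine node_lab_congr _ _ _ ?_
    rintro ⟨i, y⟩
    rfl

/-- The associator `(M ∘ N) ∘ P → M ∘ (N ∘ P)`. -/
noncomputable def associator (M N P : DGSMod k) {n : ℕ} {r : ℤ} :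
    ((M.comp N).comp P).X n r →ₗ[k] (M.comp (N.comp P)).X n r :=
  lift _ assocInner_respects

end assoc
end DGSMod

namespace DGSMod

/-- The generators of `LieD[3]`, indexed by arity and degree: `l1` is `1`, `ln` is `λ_n`, and
`l312`, for example, is `λ_{3;1,2}`. -/
inductive LieGen : ℕ → ℤ → Type
  | l1 : LieGen 1 0
  | l2 : LieGen 2 1
  | l21 : LieGen 2 2
  | l211 : LieGen 2 3
  | l2111 : LieGen 2 4
  | l3 : LieGen 3 2
  | l31 : LieGen 3 3
  | l32 : LieGen 3 3
  | l311 : LieGen 3 4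
  | l312 : LieGen 3 4
  | l322 : LieGen 3 4
  | l4 : LieGen 4 3
  | l41 : LieGen 4 4
  | l42 : LieGen 4 4
  | l43 : LieGen 4 4
  | l5 : LieGen 5 4

namespace LieGen

/-- The cycle `(c_1 c_2 … c_s)`, with entries counted from `1`: it sends `c_1` to `c_2`, and so on. -/
def cyc {n : ℕ} [NeZero n] (c : List ℕ) : Perm (Fin n) :=
  (c.map fun i => Fin.ofNat n (i - 1)).formPerm

variable (k : Type u) [CommRing k]

/-- `LieD[3](n)_r`, the free `k[S_n]`-module on the generators: the basis element `(g, σ)` is `g ^ σ`. -/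
abbrev FreeX (n : ℕ) (r : ℤ) : Type u := LieGen n r × Perm (Fin n) →₀ k

variable {k} {n : ℕ} {r : ℤ}

/-- The basis element `g ^ σ`. -/
noncomputable def el (g : LieGen n r) (σ : Perm (Fin n)) : FreeX k n r := Finsupp.single (g, σ) 1

/-- The right action, `(g ^ τ) ^ σ = g ^ (τ σ)`. -/
noncomputable def freeAct (σ : Perm (Fin n)) : FreeX k n r →ₗ[k] FreeX k n r :=
  Finsupp.lmapDomain k k fun x => (x.1, x.2 * σ)

theorem freeAct_el (σ τ : Perm (Fin n)) (g : LieGen n r) :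
    freeAct σ (el g τ : FreeX k n r) = el g (τ * σ) := by
  simp [freeAct, el]

theorem freeAct_mul (σ τ : Perm (Fin n)) (x : FreeX k n r) :
    freeAct (σ * τ) x = freeAct τ (freeAct σ x) := by
  suffices h : (freeAct (σ * τ) : FreeX k n r →ₗ[k] _) = freeAct τ ∘ₗ freeAct σ from
    LinearMap.congr_fun h x
  refine Finsupp.lhom_ext' fun ⟨g, ρ⟩ => LinearMap.ext_ring ?_
  change freeAct (σ * τ) (el g ρ) = freeAct τ (freeAct σ (el g ρ))
  simp only [freeAct_el, mul_assoc]

theorem freeAct_one (x : FreeX k n r) : freeAct 1 x = x := by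
  simp only [freeAct, mul_one]
  exact Finsupp.mapDomain_id

/-- The differential on generators. -/
noncomputable def dGen : ∀ {n : ℕ} {r : ℤ}, LieGen n r → FreeX k n (r - 1)
  | _, _, l1 | _, _, l2 | _, _, l3 | _, _, l4 | _, _, l5 => 0
  | _, _, l21 => -el l2 1 - el l2 (cyc [1, 2])
  | _, _, l211 => -el l21 1 + el l21 (cyc [1, 2])
  | _, _, l2111 => -el l211 1 - el l211 (cyc [1, 2])
  | _, _, l31 => -el l3 1 - el l3 (cyc [1, 2])
  | _, _, l32 => -el l3 1 - el l3 (cyc [2, 3])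
  | _, _, l311 => -el l31 1 + el l31 (cyc [1, 2])
  | _, _, l312 => el l31 1 + el l31 (cyc [2, 3]) + el l31 (cyc [1, 3, 2])
      - el l32 1 - el l32 (cyc [1, 2]) - el l32 (cyc [1, 2, 3])
  | _, _, l322 => -el l32 1 + el l32 (cyc [2, 3])
  | _, _, l41 => -el l4 1 - el l4 (cyc [1, 2])
  | _, _, l42 => -el l4 1 - el l4 (cyc [2, 3])
  | _, _, l43 => -el l4 1 - el l4 (cyc [3, 4])

/-- The differential, the `S`-equivariant extension of its values on generators. -/
noncomputable def freeD : FreeX k n r →ₗ[k] FreeX k n (r - 1) :=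
  Finsupp.linearCombination k fun x => freeAct x.2 (dGen x.1)

theorem freeD_el (g : LieGen n r) (σ : Perm (Fin n)) :
    freeD (el g σ : FreeX k n r) = freeAct σ (dGen g) := by
  simp [freeD, el]

theorem freeD_act (σ : Perm (Fin n)) (x : FreeX k n r) :
    freeD (freeAct σ x) = freeAct σ (freeD x) := by
  suffices h : (freeD ∘ₗ freeAct σ : FreeX k n r →ₗ[k] _) = freeAct σ ∘ₗ freeD from
    LinearMap.congr_fun h x
  refine Finsupp.lhom_ext' fun ⟨g, ρ⟩ => LinearMap.ext_ring ?_
  change freeD (freeAct σ (el g ρ)) = freeAct σ (freeD (el g ρ))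
  rw [freeAct_el, freeD_el, freeD_el, freeAct_mul]

theorem freeD_dGen (g : LieGen n r) : freeD (dGen g : FreeX k n (r - 1)) = 0 := by
  have h2 : (cyc [1, 2] * cyc [1, 2] : Perm (Fin 2)) = 1 := by decide
  have h3 : (cyc [1, 2] * cyc [1, 2] : Perm (Fin 3)) = 1 := by decide
  have h3' : (cyc [2, 3] * cyc [2, 3] : Perm (Fin 3)) = 1 := by decide
  have e1 : (cyc [1, 2] * cyc [2, 3] : Perm (Fin 3)) = cyc [1, 2, 3] := by decide
  have e3 : (cyc [2, 3] * cyc [1, 2] : Perm (Fin 3)) = cyc [1, 3, 2] := by decide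
  have e4 : (cyc [2, 3] * cyc [1, 2, 3] : Perm (Fin 3)) = cyc [1, 3] := by decide
  have e2 : (cyc [1, 2] * cyc [1, 3, 2] : Perm (Fin 3)) = cyc [1, 3] := by decide
  cases g <;>
    simp only [dGen, map_zero, map_add, map_sub, map_neg, freeD_el, freeAct_el, one_mul, mul_one, h2, h3,
      h3', e1, e2, e3, e4]
  all_goals abel

theorem freeD_freeD (x : FreeX k n r) : freeD (freeD x) = 0 := by
  suffices h : (freeD ∘ₗ freeD : FreeX k n r →ₗ[k] _) = 0 from LinearMap.congr_fun h x
  refine Finsupp.lhom_ext' fun ⟨g, ρ⟩ => LinearMap.ext_ring ?_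
  change freeD (freeD (el g ρ)) = 0
  rw [freeD_el, freeD_act, freeD_dGen, map_zero]

end LieGen

open LieGen

/-- The `S`-free dg `S`-module `LieD[3]`. -/
@[reducible] noncomputable def LieD3 (k : Type u) [CommRing k] : DGSMod k where
  X := FreeX k
  act := freeAct
  act_one := freeAct_one
  act_mul := freeAct_mul
  d := freeD
  d_d := freeD_freeD
  d_act := freeD_act

namespace LieD3

variable {k : Type u} [CommRing k] {n m : ℕ} {r p : ℤ}

/-- A generator together with its arity and degree. -/
def S {n : ℕ} {r : ℤ} (g : LieGen n r) : Σ (n : ℕ) (r : ℤ), LieGen n r := ⟨n, r, g⟩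

/-- The element `(μ ∘ (ν_1, …, ν_m)) ^ σ`, for generators `μ` and `ν_i`. -/
noncomputable def tm (μ : LieGen m p) (ν : Fin m → Σ (n : ℕ) (r : ℤ), LieGen n r)
    (σ : Perm (Fin n)) (hn : ∑ i, (ν i).1 = n := by decide)
    (hr : p + ∑ i, (ν i).2.1 = r := by decide) : CompX (LieD3 k) (LieD3 k) n r :=
  CompX.act σ (CompX.node (M := LieD3 k) (N := LieD3 k) (el μ 1) (ar := fun i => (ν i).1)
    (q := fun i => (ν i).2.1) (finSigmaFinEquiv.trans (finCongr hn)) hr fun i => el (ν i).2.2 1)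

/-- The reduced decomposition of the generators. On `λ_n` it is that of the Koszul dual cooperad of the
Leibniz operad: the sum of
`(-1)^((j-1)(n-j) + ∑ (a-1)(i_a - 1)) sgn(σ) (λ_j ∘ (λ_{i_1}, …, λ_{i_j})) ^ σ` over `1 < j < n`, all
`i_1 + ⋯ + i_j = n`, and all `σ` such that `σ⁻¹` is increasing on each of the `j` blocks and the values
at the last places of the blocks increase from block to block. -/
noncomputable def redDecomp : ∀ {n : ℕ} {r : ℤ}, LieGen n r → CompX (LieD3 k) (LieD3 k) n r
  | _, _, .l1 => 0
  | _, _, .l2 => 0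
  | _, _, .l21 => 0
  | _, _, .l211 => 0
  | _, _, .l2111 => 0
  | _, _, .l3 =>
    -tm .l2 ![S .l2, S .l1] 1 + tm .l2 ![S .l1, S .l2] 1 - tm .l2 ![S .l1, S .l2] (cyc [1, 2])
  | _, _, .l31 =>
    tm .l2 ![S .l21, S .l1] 1
  | _, _, .l32 =>
    -tm .l21 ![S .l2, S .l1] 1 - tm .l2 ![S .l1, S .l21] 1 - tm .l21 ![S .l1, S .l2] (cyc [1, 2])
  | _, _, .l311 =>
    -tm .l2 ![S .l211, S .l1] 1
  | _, _, .l312 =>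
    -tm .l21 ![S .l21, S .l1] 1 - tm .l21 ![S .l1, S .l21] 1 - tm .l21 ![S .l1, S .l21] (cyc [1, 2])
    + tm .l211 ![S .l1, S .l2] (cyc [1, 3, 2])
  | _, _, .l322 =>
    -tm .l211 ![S .l2, S .l1] 1 + tm .l2 ![S .l1, S .l211] 1 - tm .l211 ![S .l1, S .l2] (cyc [1, 2])
  | _, _, .l4 =>
    tm .l2 ![S .l3, S .l1] 1 + tm .l2 ![S .l1, S .l3] 1 - tm .l2 ![S .l1, S .l3] (cyc [1, 2]) +
    tm .l2 ![S .l1, S .l3] (cyc [1, 2, 3]) - tm .l2 ![S .l2, S .l2] 1 +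
    tm .l2 ![S .l2, S .l2] (cyc [2, 3]) - tm .l2 ![S .l2, S .l2] (cyc [1, 3, 2]) +
    tm .l3 ![S .l2, S .l1, S .l1] 1 - tm .l3 ![S .l1, S .l2, S .l1] 1 +
    tm .l3 ![S .l1, S .l2, S .l1] (cyc [1, 2]) + tm .l3 ![S .l1, S .l1, S .l2] 1 -
    tm .l3 ![S .l1, S .l1, S .l2] (cyc [2, 3]) + tm .l3 ![S .l1, S .l1, S .l2] (cyc [1, 3, 2])
  | _, _, .l41 =>
    -tm .l2 ![S .l31, S .l1] 1 - tm .l2 ![S .l1, S .l31] (cyc [1, 2, 3]) + tm .l2 ![S .l21, S .l2] 1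
    + tm .l3 ![S .l21, S .l1, S .l1] 1 + tm .l31 ![S .l1, S .l1, S .l2] 1
  | _, _, .l42 =>
    -tm .l2 ![S .l32, S .l1] 1 - tm .l2 ![S .l1, S .l31] 1 + tm .l2 ![S .l21, S .l2] (cyc [1, 3, 2])
    + tm .l31 ![S .l2, S .l1, S .l1] 1 + tm .l31 ![S .l1, S .l2, S .l1] (cyc [1, 2]) -
    tm .l3 ![S .l1, S .l21, S .l1] 1 + tm .l31 ![S .l1, S .l1, S .l2] (cyc [1, 3, 2])
  | _, _, .l43 =>
    tm .l21 ![S .l1, S .l3] (cyc [1, 2, 3]) - tm .l2 ![S .l1, S .l32] 1 +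
    tm .l2 ![S .l1, S .l32] (cyc [1, 2]) + tm .l21 ![S .l3, S .l1] 1 - tm .l2 ![S .l2, S .l21] 1 -
    tm .l21 ![S .l2, S .l2] (cyc [1, 3, 2]) + tm .l21 ![S .l2, S .l2] (cyc [2, 3]) +
    tm .l32 ![S .l2, S .l1, S .l1] 1 - tm .l32 ![S .l1, S .l1, S .l2] (cyc [2, 3]) +
    tm .l32 ![S .l1, S .l1, S .l2] (cyc [1, 3, 2]) + tm .l3 ![S .l1, S .l1, S .l21] 1 -
    tm .l32 ![S .l1, S .l2, S .l1] 1 + tm .l32 ![S .l1, S .l2, S .l1] (cyc [1, 2])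
  | _, _, .l5 =>
    -tm .l2 ![S .l4, S .l1] 1 + tm .l2 ![S .l3, S .l2] 1 - tm .l2 ![S .l3, S .l2] (cyc [3, 4]) +
    tm .l2 ![S .l3, S .l2] (cyc [2, 4, 3]) - tm .l2 ![S .l3, S .l2] (cyc [1, 4, 3, 2]) -
    tm .l2 ![S .l2, S .l3] 1 + tm .l2 ![S .l2, S .l3] (cyc [2, 3]) -
    tm .l2 ![S .l2, S .l3] (cyc [2, 3, 4]) - tm .l2 ![S .l2, S .l3] (cyc [1, 3, 2]) +
    tm .l2 ![S .l2, S .l3] (cyc [1, 3, 4, 2]) - tm .l2 ![S .l2, S .l3] (cyc [1, 3] * cyc [2, 4]) +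
    tm .l2 ![S .l1, S .l4] 1 - tm .l2 ![S .l1, S .l4] (cyc [1, 2]) +
    tm .l2 ![S .l1, S .l4] (cyc [1, 2, 3]) - tm .l2 ![S .l1, S .l4] (cyc [1, 2, 3, 4]) +
    tm .l3 ![S .l3, S .l1, S .l1] 1 - tm .l3 ![S .l2, S .l2, S .l1] 1 +
    tm .l3 ![S .l2, S .l2, S .l1] (cyc [2, 3]) - tm .l3 ![S .l2, S .l2, S .l1] (cyc [1, 3, 2]) +
    tm .l3 ![S .l2, S .l1, S .l2] 1 + tm .l3 ![S .l2, S .l1, S .l2] (cyc [2, 4, 3]) -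
    tm .l3 ![S .l2, S .l1, S .l2] (cyc [3, 4]) - tm .l3 ![S .l2, S .l1, S .l2] (cyc [1, 4, 3, 2]) +
    tm .l3 ![S .l1, S .l3, S .l1] 1 - tm .l3 ![S .l1, S .l3, S .l1] (cyc [1, 2]) +
    tm .l3 ![S .l1, S .l3, S .l1] (cyc [1, 2, 3]) - tm .l3 ![S .l1, S .l2, S .l2] 1 +
    tm .l3 ![S .l1, S .l2, S .l2] (cyc [3, 4]) - tm .l3 ![S .l1, S .l2, S .l2] (cyc [2, 4, 3]) +
    tm .l3 ![S .l1, S .l2, S .l2] (cyc [1, 2]) -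
    tm .l3 ![S .l1, S .l2, S .l2] (cyc [1, 2] * cyc [3, 4]) +
    tm .l3 ![S .l1, S .l2, S .l2] (cyc [1, 2, 4, 3]) - tm .l3 ![S .l1, S .l2, S .l2] (cyc [1, 4, 3])
    + tm .l3 ![S .l1, S .l2, S .l2] (cyc [1, 4, 3, 2]) + tm .l3 ![S .l1, S .l1, S .l3] 1 -
    tm .l3 ![S .l1, S .l1, S .l3] (cyc [2, 3]) + tm .l3 ![S .l1, S .l1, S .l3] (cyc [2, 3, 4]) +
    tm .l3 ![S .l1, S .l1, S .l3] (cyc [1, 3, 2]) - tm .l3 ![S .l1, S .l1, S .l3] (cyc [1, 3, 4, 2])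
    + tm .l3 ![S .l1, S .l1, S .l3] (cyc [1, 3] * cyc [2, 4]) -
    tm .l4 ![S .l2, S .l1, S .l1, S .l1] 1 + tm .l4 ![S .l1, S .l2, S .l1, S .l1] 1 -
    tm .l4 ![S .l1, S .l2, S .l1, S .l1] (cyc [1, 2]) - tm .l4 ![S .l1, S .l1, S .l2, S .l1] 1 +
    tm .l4 ![S .l1, S .l1, S .l2, S .l1] (cyc [2, 3]) -
    tm .l4 ![S .l1, S .l1, S .l2, S .l1] (cyc [1, 3, 2]) + tm .l4 ![S .l1, S .l1, S .l1, S .l2] 1 -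
    tm .l4 ![S .l1, S .l1, S .l1, S .l2] (cyc [3, 4]) +
    tm .l4 ![S .l1, S .l1, S .l1, S .l2] (cyc [2, 4, 3]) -
    tm .l4 ![S .l1, S .l1, S .l1, S .l2] (cyc [1, 4, 3, 2])

/-- The full decomposition of the generators: `Δ(1) = 1 ∘ (1)`, and otherwise
`Δ(g) = 1 ∘ (g) + Δ̄(g) + g ∘ (1, …, 1)`. -/
noncomputable def decompGen : ∀ {n : ℕ} {r : ℤ}, LieGen n r → CompX (LieD3 k) (LieD3 k) n r
  | _, _, .l1 => tm .l1 ![S .l1] 1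
  | _, _, g => tm .l1 (fun _ => S g) 1 (by simp [S]) (by simp [S]) + redDecomp g
      + tm g (fun _ => S .l1) 1 (by simp [S]) (by simp [S])

/-- The decomposition map as a linear map: the `S`-equivariant extension of `decompGen`. -/
noncomputable def decompLin : FreeX k n r →ₗ[k] CompX (LieD3 k) (LieD3 k) n r :=
  Finsupp.linearCombination k fun x => CompX.act x.2 (decompGen x.1)

theorem decompLin_el (g : LieGen n r) (σ : Perm (Fin n)) :
    decompLin (el g σ : FreeX k n r) = CompX.act σ (decompGen g) := by
  simp [decompLin, el]

/-- The decomposition map `Δ : LieD[3] → LieD[3] ∘ LieD[3]`. -/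
noncomputable def decomp : SHom (LieD3 k) ((LieD3 k).comp (LieD3 k)) where
  map := decompLin
  map_act {n r} σ x := by
    suffices h : (decompLin ∘ₗ freeAct σ : FreeX k n r →ₗ[k] CompX (LieD3 k) (LieD3 k) n r) =
        CompX.act σ ∘ₗ decompLin from LinearMap.congr_fun h x
    refine Finsupp.lhom_ext' fun ⟨g, ρ⟩ => LinearMap.ext_ring ?_
    change decompLin (freeAct σ (el g ρ)) = CompX.act σ (decompLin (el g ρ))
    rw [freeAct_el, decompLin_el, decompLin_el, CompX.act_mul]

/-- The counit on generators: `1 ↦ 1`, and every other generator goes to `0`. -/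
def counitGen : ∀ {n : ℕ} {r : ℤ}, LieGen n r → (unit k).X n r
  | _, _, .l1 => unit.one
  | _, _, _ => 0

/-- The counit `ε : LieD[3] → I`, the projection onto arity `1`. -/
noncomputable def counit : SHom (LieD3 k) (unit k) where
  map {n r} := (Finsupp.linearCombination k fun x => counitGen x.1 : FreeX k n r →ₗ[k] _)
  map_act {n r} σ x := by
    suffices h : (Finsupp.linearCombination k (fun x => counitGen x.1) ∘ₗ freeAct σ :
        FreeX k n r →ₗ[k] (unit k).X n r) = Finsupp.linearCombination k fun x => counitGen x.1 from
      LinearMap.congr_fun h x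
    refine Finsupp.lhom_ext' fun ⟨g, ρ⟩ => LinearMap.ext_ring ?_
    simp [freeAct]

end LieD3

/-- A dg `S`-module is `S`-free if, in every arity `n` and degree `r`, it is a free `k[S_n]`-module:
it has a `k`-basis `b (i, σ)`, with `i` in some index set and `σ ∈ S_n`, on which `S_n` acts by
`b (i, σ) ^ τ = b (i, σ τ)`. -/
def IsSFree {k : Type u} [CommRing k] (M : DGSMod k) : Prop :=
  ∀ (n : ℕ) (r : ℤ), ∃ (ι : Type) (b : Module.Basis (ι × Perm (Fin n)) k (M.X n r)),
    ∀ i σ τ, M.act τ (b (i, σ)) = b (i, σ * τ)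

/-- `(C, Δ, ε)` is a dg cooperad: a comonoid, for the composite product, in dg `S`-modules. The
maps `Δ` and `ε` are `S`-equivariant of degree `0` by their type. -/
structure IsDGCooperad {k : Type u} [CommRing k] (C : DGSMod k) (Δ : SHom C (C.comp C))
    (ε : SHom C (unit k)) : Prop where
  /-- `Δ` is a chain map. -/
  decomp_d : ∀ {n : ℕ} {r : ℤ} (x : C.X n r), Δ.map (C.d x) = (C.comp C).d (Δ.map x)
  /-- `ε` is a chain map. -/
  counit_d : ∀ {n : ℕ} {r : ℤ} (x : C.X n r), ε.map (C.d x) = (unit k).d (ε.map x)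
  /-- `(Δ ∘ id) Δ = (id ∘ Δ) Δ`, up to the associator `(C ∘ C) ∘ C ≅ C ∘ (C ∘ C)`. -/
  coassoc : ∀ {n : ℕ} {r : ℤ} (x : C.X n r),
    associator C C C ((Δ.comp (SHom.id C)).map (Δ.map x)) = ((SHom.id C).comp Δ).map (Δ.map x)
  /-- `(ε ∘ id) Δ` is the canonical isomorphism `C ≅ I ∘ C`. -/
  counit_left : ∀ {n : ℕ} {r : ℤ} (x : C.X n r),
    (ε.comp (SHom.id C)).map (Δ.map x) = leftUnitorInv C x
  /-- `(id ∘ ε) Δ` is the canonical isomorphism `C ≅ C ∘ I`. -/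
  counit_right : ∀ {n : ℕ} {r : ℤ} (x : C.X n r),
    ((SHom.id C).comp ε).map (Δ.map x) = rightUnitorInv C x

end DGSMod

/-!
All the maps in the cooperad axioms are linear and equivariant, so it suffices to compare them on
the sixteen generators. There, each side is an integer combination of two- or three-level trees of
generators. The relations of the composite product move every permutation into the labels of the
inputs, at the price of a Koszul sign, so these trees have a normal form: generators decorated only
by an injective labelling of the inputs. Compatibility with the differential and coassociativity
become equalities of coefficients of such labelled trees, which the kernel computes.

The counit axioms need no computation of trees: in each term of the reduced decomposition the top
vertex and some bottom entry have arity different from `1`, so `ε` annihilates it on either side,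
and `1 ∘ (g)` and `g ∘ (1, …, 1)` give the two unit isomorphisms.
-/

namespace DGSMod

open CompX LieGen LieD3

section Graft

variable {k : Type u} [CommRing k] {M N P : DGSMod k} {n m : ℕ} {r p : ℤ} {A : Type*}

/-- A homogeneous element of a dg `S`-module whose inputs carry labels in `A`. A tree is determined
by its top entry and its labelled bottom entries. -/
structure Entry (N : DGSMod k) (A : Type*) where
  ar : ℕ
  deg : ℤ
  val : N.X ar deg
  lab : Fin ar → A

namespace Entry

/-- The entry with its element changed by the differential. -/
def diff (y : Entry N A) : Entry N A := ⟨y.ar, y.deg - 1, N.d y.val, y.lab⟩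

/-- The composite `v ∘ (y 0, …, y (b - 1))`, the inputs of the `y t` keeping their labels. -/
noncomputable def comp {b : ℕ} {w : ℤ} (v : N.X b w) (y : Fin b → Entry P A) :
    Entry (N.comp P) A where
  ar := ∑ t, (y t).ar
  deg := w + ∑ t, (y t).deg
  val := (node v finSigmaFinEquiv rfl fun t => (y t).val : CompX N P _ _)
  lab s := (y (finSigmaFinEquiv.symm s).1).lab (finSigmaFinEquiv.symm s).2

/-- Two entries are related if the second is obtained from the first by moving a permutation of the
inputs from the element to the labels. -/
def Rel (y z : Entry N A) : Prop :=
  ∃ (τ : Perm (Fin y.ar)) (v : N.X y.ar y.deg),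
    N.act τ v = y.val ∧ ⟨y.ar, y.deg, v, y.lab ∘ τ.symm⟩ = z

theorem Rel.refl (y : Entry N A) : y.Rel y := ⟨1, y.val, N.act_one _, rfl⟩

end Entry

/-- The labels of the inputs of all the entries `y i`. -/
def inputLabel (y : Fin m → Entry N A) (x : Σ i, Fin (y i).ar) : A := (y x.1).lab x.2

/-- The entries `y i` can be grafted on a vertex of degree `p` to form a tree of arity `n` and
degree `r`. -/
structure Fits (r p : ℤ) (y : Fin m → Entry N (Fin n)) : Prop where
  bijective : Function.Bijective (inputLabel y)
  deg : p + ∑ i, (y i).deg = r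

/-- The labelled bottom entries of a tree. -/
def entries {ar : Fin m → ℕ} {q : Fin m → ℤ} (lab : (Σ i, Fin (ar i)) → A)
    (bot : ∀ i, N.X (ar i) (q i)) (i : Fin m) : Entry N A :=
  ⟨ar i, q i, bot i, fun t => lab ⟨i, t⟩⟩

namespace CompX

/-- The class of a tree, as a linear function of its top entry. -/
noncomputable def nodeTop {ar : Fin m → ℕ} {q : Fin m → ℤ} (lab : (Σ i, Fin (ar i)) ≃ Fin n)
    (h : p + ∑ i, q i = r) (bot : ∀ i, N.X (ar i) (q i)) : M.X m p →ₗ[k] CompX M N n r where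
  toFun x := node x lab h bot
  map_add' x y := node_add x y lab h bot
  map_smul' c x := node_smul c x lab h bot

end CompX

open Classical in
/-- The tree with top entry `x` and bottom entries `y i`, as a linear function of `x`; it is `0` by
convention if the `y i` do not fit. -/
noncomputable def graft (r : ℤ) (y : Fin m → Entry N (Fin n)) : M.X m p →ₗ[k] CompX M N n r :=
  if h : Fits r p y then nodeTop (Equiv.ofBijective _ h.bijective) h.deg fun i => (y i).val else 0

theorem graft_of_not_fits {y : Fin m → Entry N (Fin n)} (h : ¬ Fits r p y) (x : M.X m p) :
    graft r y x = 0 := by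
  rw [graft, dif_neg h, LinearMap.zero_apply]

theorem graft_eq_node {y : Fin m → Entry N (Fin n)} (e : (Σ i, Fin (y i).ar) ≃ Fin n)
    (he : ⇑e = inputLabel y) (hd : p + ∑ i, (y i).deg = r) (x : M.X m p) :
    graft r y x = node x e hd fun i => (y i).val := by
  rw [graft, dif_pos ⟨he ▸ e.bijective, hd⟩]
  exact node_lab_congr _ _ _ fun s => (congrFun he s).symm

theorem Fits.exists_equiv {y : Fin m → Entry N (Fin n)} (h : Fits r p y) :
    ∃ e : (Σ i, Fin (y i).ar) ≃ Fin n, ⇑e = inputLabel y :=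
  ⟨Equiv.ofBijective _ h.bijective, rfl⟩

theorem node_eq_graft (x : M.X m p) {ar : Fin m → ℕ} {q : Fin m → ℤ}
    (lab : (Σ i, Fin (ar i)) ≃ Fin n) (h : p + ∑ i, q i = r) (bot : ∀ i, N.X (ar i) (q i)) :
    node x lab h bot = graft r (entries lab bot) x :=
  (graft_eq_node (y := entries lab bot) lab rfl h x).symm

theorem graft_congr_rel {y z : Fin m → Entry N (Fin n)} (h : ∀ i, (y i).Rel (z i)) (x : M.X m p) :
    graft r y x = graft r z x := by
  choose τ v hv hz using h
  obtain rfl : (fun i => ⟨(y i).ar, (y i).deg, v i, (y i).lab ∘ (τ i).symm⟩) = z := funext hz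
  let φ : (Σ i, Fin (y i).ar) ≃ Σ i, Fin (y i).ar := Equiv.sigmaCongrRight fun i => (τ i).symm
  by_cases hf : Fits r p y
  · obtain ⟨e, he⟩ := hf.exists_equiv
    rw [graft_eq_node e he hf.deg, ← funext hv, node_bot_act]
    exact (graft_eq_node (y := fun i => ⟨_, _, v i, (y i).lab ∘ (τ i).symm⟩) (φ.trans e)
      (congrArg (· ∘ φ) he) hf.deg x).symm
  · rw [graft_of_not_fits hf, graft_of_not_fits]
    exact fun h => hf ⟨(Function.Bijective.of_comp_iff _ φ.bijective).1 h.bijective, h.deg⟩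

theorem graft_act (y : Fin m → Entry N (Fin n)) (σ : Perm (Fin m)) (x : M.X m p) :
    graft r y (M.act σ x) =
      (koszulSign (fun i => (y i).deg) (fun i => i) (fun i => σ i) : ℤ) •
        graft r (y ∘ σ.symm) x := by
  let φ : (Σ i, Fin (y (σ.symm i)).ar) ≃ Σ i, Fin (y i).ar :=
    Equiv.sigmaCongrLeft (β := fun i => Fin (y i).ar) σ.symm
  have hsum : ∑ i, (y (σ.symm i)).deg = ∑ i, (y i).deg := Equiv.sum_comp σ.symm fun i => (y i).deg
  by_cases hf : Fits r p y
  · obtain ⟨e, he⟩ := hf.exists_equiv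
    rw [graft_eq_node e he hf.deg, node_top_act, Int.cast_smul_eq_zsmul]
    exact congrArg _ (graft_eq_node (y := y ∘ σ.symm) (φ.trans e) (congrArg (· ∘ φ) he)
      (hsum ▸ hf.deg) x).symm
  · have hf' : ¬ Fits r p (y ∘ σ.symm) := fun h =>
      hf ⟨(Function.Bijective.of_comp_iff (inputLabel y) φ.bijective).1 h.bijective, hsum ▸ h.deg⟩
    rw [graft_of_not_fits hf, graft_of_not_fits hf', smul_zero]

/-- The tree as a multilinear function of its bottom entries, with the arities, degrees and labels
of the `y i`; it is `0` by convention if the `y i` do not fit. -/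
noncomputable def graftBots (r : ℤ) (y : Fin m → Entry N (Fin n)) (x : M.X m p) :
    MultilinearMap k (fun i => N.X (y i).ar (y i).deg) (CompX M N n r) :=
  open Classical in if h : Fits r p y then node x (Equiv.ofBijective _ h.bijective) h.deg else 0

theorem graftBots_apply (y : Fin m → Entry N (Fin n)) (x : M.X m p)
    (v : ∀ i, N.X (y i).ar (y i).deg) :
    graftBots r y x v = graft r (entries (inputLabel y) v) x := by
  by_cases hf : Fits r p y
  · rw [graftBots, dif_pos hf, node_eq_graft]
    rfl
  · have hf' : ¬ Fits r p (entries (inputLabel y) v) := fun h => hf ⟨h.bijective, h.deg⟩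
    rw [graftBots, dif_neg hf, graft_of_not_fits hf']
    rfl

theorem isLinearMap_graft_update (y : Fin m → Entry N (Fin n)) (i : Fin m) {a : ℕ} {q : ℤ}
    (l : Fin a → Fin n) (x : M.X m p) :
    IsLinearMap k fun v : N.X a q => graft r (Function.update y i ⟨a, q, v, l⟩) x := by
  suffices h : ∀ y : Fin m → Entry N (Fin n), IsLinearMap k fun v : N.X (y i).ar (y i).deg =>
      graft r (Function.update y i ⟨_, _, v, (y i).lab⟩) x by
    have h0 := h (Function.update y i ⟨a, q, 0, l⟩)
    rw [Function.update_self] at h0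
    simpa only [Function.update_idem] using h0
  intro y
  have hy : ∀ v, Function.update y i ⟨_, _, v, (y i).lab⟩ =
      entries (inputLabel y) (Function.update (fun j => (y j).val) i v) := by
    intro v
    funext j
    obtain rfl | hj := eq_or_ne j i
    · simp only [entries, Function.update_self, inputLabel]
    · simp only [entries, Function.update_of_ne hj, inputLabel]
  simp_rw [hy, ← graftBots_apply]
  exact ((graftBots r y x).toLinearMap (fun j => (y j).val) i).isLinear

theorem entry_castTo {a : ℕ} {q q' : ℤ} (h : q' = q) (v : N.X a q) (l : Fin a → A) :
    (⟨a, q', N.castTo h v, l⟩ : Entry N A) = ⟨a, q, v, l⟩ := by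
  subst h
  rfl

theorem entries_shift {ar : Fin m → ℕ} {q : Fin m → ℤ} (lab : (Σ i, Fin (ar i)) → A)
    (bot : ∀ i, N.X (ar i) (q i)) (i : Fin m) :
    entries lab (fun j => shift N ar q i j (bot j)) =
      Function.update (entries lab bot) i (entries lab bot i).diff := by
  funext j
  obtain rfl | hj := eq_or_ne j i
  · rw [Function.update_self, entries, shift, dif_pos rfl, dTo]
    exact entry_castTo _ _ _
  · rw [Function.update_of_ne hj, entries, shift, dif_neg hj]
    exact entry_castTo _ _ _

theorem d_node_eq_graft (x : M.X m p) {ar : Fin m → ℕ} {q : Fin m → ℤ}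
    (lab : (Σ i, Fin (ar i)) ≃ Fin n) (h : p + ∑ i, q i = r) (bot : ∀ i, N.X (ar i) (q i)) :
    CompX.d (node x lab h bot) = graft (r - 1) (entries lab bot) (M.d x) +
      ∑ i, (prefixSign p q i : ℤ) •
        graft (r - 1) (Function.update (entries lab bot) i (entries lab bot i).diff) x := by
  rw [d_node, node_eq_graft]
  congr 1
  refine Finset.sum_congr rfl fun i _ => ?_
  rw [dBot_apply, node_eq_graft, entries_shift, Int.cast_smul_eq_zsmul]

theorem map_node {M' N' : DGSMod k} (f : SHom M M') (g : SHom N N') (x : M.X m p)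
    {ar : Fin m → ℕ} {q : Fin m → ℤ} (lab : (Σ i, Fin (ar i)) ≃ Fin n) (h : p + ∑ i, q i = r)
    (bot : ∀ i, N.X (ar i) (q i)) :
    CompX.map f g (node x lab h bot) = node (f.map x) lab h fun i => g.map (bot i) :=
  lift_mk ..

theorem Entry.rel_comp {b c : ℕ} {w s : ℤ} (v : N.X b w) {ar : Fin b → ℕ} {q : Fin b → ℤ}
    (lab : (Σ i, Fin (ar i)) ≃ Fin c) (h : w + ∑ i, q i = s) (bot : ∀ i, P.X (ar i) (q i))
    (l : Fin c → A) :
    Rel (⟨c, s, (node v lab h bot : CompX N P c s), l⟩ : Entry (N.comp P) A)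
      (comp v (entries (l ∘ lab) bot)) := by
  obtain rfl : c = ∑ t, ar t := by simpa using (Fintype.card_congr lab).symm
  subst h
  let τ : Perm (Fin (∑ t, ar t)) := lab.symm.trans finSigmaFinEquiv
  exact ⟨τ, (node v finSigmaFinEquiv rfl bot : CompX N P _ _),
    (act_node ..).trans (node_lab_congr _ _ _ fun s => by simp [τ]), rfl⟩

theorem node_node (x : M.X m p) {b : Fin m → ℕ} {w : Fin m → ℤ} (v : ∀ i, N.X (b i) (w i))
    {ar : ∀ i, Fin (b i) → ℕ} {q : ∀ i, Fin (b i) → ℤ} {c : Fin m → ℕ} {s : Fin m → ℤ}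
    (lab : (Σ i, Fin (c i)) ≃ Fin n) (h : p + ∑ i, s i = r)
    (lab' : ∀ i, (Σ t, Fin (ar i t)) ≃ Fin (c i)) (h' : ∀ i, w i + ∑ t, q i t = s i)
    (bot : ∀ i t, P.X (ar i t) (q i t)) :
    node (N := N.comp P) x lab h (fun i => (node (v i) (lab' i) (h' i) (bot i) : CompX N P _ _)) =
      graft r (fun i => Entry.comp (v i) (entries (fun t => lab ⟨i, lab' i t⟩) (bot i))) x := by
  rw [node_eq_graft]
  exact graft_congr_rel (fun i => Entry.rel_comp _ _ _ _ _) x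

theorem associator_node_node {l : ℕ} {p' : ℤ} (x : M.X l p') {b : Fin l → ℕ} {w : Fin l → ℤ}
    (e : (Σ i, Fin (b i)) ≃ Fin m) (hd : p' + ∑ i, w i = p) (v : ∀ i, N.X (b i) (w i))
    {ar : Fin m → ℕ} {q : Fin m → ℤ} (lab : (Σ j, Fin (ar j)) ≃ Fin n) (h : p + ∑ j, q j = r)
    (bot : ∀ j, P.X (ar j) (q j)) :
    associator M N P (node (M := M.comp N) (node x e hd v : CompX M N m p) lab h bot) =
      (assocSign e w q : ℤ) • graft (N := N.comp P) r
        (fun i => Entry.comp (v i) fun t => entries lab bot (e ⟨i, t⟩)) x := by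
  refine (lift_mk _ assocInner_respects _).trans ?_
  refine (lift_mk _ (assocTree_respects lab h bot) _).trans ?_
  rw [assocTree, Int.cast_smul_eq_zsmul, assocNode]
  refine congrArg _ (graft_eq_node (N := N.comp P)
    (y := fun i => Entry.comp (v i) fun t => entries lab bot (e ⟨i, t⟩))
    (assocLab e lab fun _ => finSigmaFinEquiv) ?_ (assoc_deg e w q hd h) x).symm
  funext ⟨i, s⟩
  obtain ⟨⟨t, j⟩, rfl⟩ := finSigmaFinEquiv.surjective s
  refine (assocLab_apply e lab (fun _ => finSigmaFinEquiv) i t j).trans ?_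
  change _ = (fun u : Σ t, Fin (ar (e ⟨i, t⟩)) => lab ⟨e ⟨i, u.1⟩, u.2⟩)
    (finSigmaFinEquiv.symm (finSigmaFinEquiv ⟨t, j⟩))
  rw [Equiv.symm_apply_apply]

end Graft

section FormalSum

variable {A B V W : Type*} [AddCommGroup V] [AddCommGroup W]

/-- Formal integer combinations, encoded as lists of terms so that they can be computed with. -/
abbrev FormalSum (A : Type*) := List (ℤ × A)

/-- The value `∑ c • f a` of a formal sum of terms `(c, a)`. -/
def linComb (f : A → V) (L : FormalSum A) : V := (L.map fun q => q.1 • f q.2).sum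

@[simp] theorem linComb_nil (f : A → V) : linComb f [] = 0 := rfl

@[simp] theorem linComb_cons (f : A → V) (q : ℤ × A) (L : FormalSum A) :
    linComb f (q :: L) = q.1 • f q.2 + linComb f L := rfl

theorem linComb_singleton (f : A → V) (q : ℤ × A) : linComb f [q] = q.1 • f q.2 := by
  rw [linComb_cons, linComb_nil, add_zero]

theorem linComb_append (f : A → V) (L L' : FormalSum A) :
    linComb f (L ++ L') = linComb f L + linComb f L' := by simp [linComb]

theorem map_linComb {F : Type*} [FunLike F V W] [AddMonoidHomClass F V W] (φ : F) (f : A → V)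
    (L : FormalSum A) : φ (linComb f L) = linComb (fun a => φ (f a)) L := by
  simp only [linComb, map_list_sum, List.map_map, Function.comp_def, map_zsmul]

theorem linComb_map_mul (c : ℤ) (f : A → V) (L : FormalSum A) :
    linComb f (L.map fun q => (c * q.1, q.2)) = c • linComb f L := by
  simp only [linComb, List.map_map, Function.comp_def, List.smul_sum, mul_smul]

theorem linComb_eq_zero {f : A → V} {L : FormalSum A} (h : ∀ q ∈ L, f q.2 = 0) :
    linComb f L = 0 :=
  List.sum_eq_zero fun v hv => by
    obtain ⟨q, hq, rfl⟩ := List.mem_map.1 hv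
    rw [h q hq, smul_zero]

/-- Substitution of formal sums into a formal sum. -/
def FormalSum.bind (L : FormalSum A) (T : A → FormalSum B) : FormalSum B :=
  L.flatMap fun q => (T q.2).map fun t => (q.1 * t.1, t.2)

theorem linComb_bind (f : B → V) (L : FormalSum A) (T : A → FormalSum B) :
    linComb f (L.bind T) = linComb (fun a => linComb f (T a)) L := by
  induction L with
  | nil => rfl
  | cons q L ih =>
    rw [FormalSum.bind, List.flatMap_cons, linComb_append, linComb_map_mul, linComb_cons, ← ih]
    rfl

theorem linComb_flatMap_finRange {m : ℕ} (f : A → V) (T : Fin m → FormalSum A) :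
    linComb f ((List.finRange m).flatMap T) = ∑ i, linComb f (T i) := by
  rw [Fin.sum_univ_def]
  induction List.finRange m with
  | nil => rfl
  | cons i l ih => rw [List.flatMap_cons, linComb_append, ih, List.map_cons, List.sum_cons]

/-- All ways of choosing one term from each of the formal sums `T i`, with the products of their
coefficients. -/
def choices : ∀ {m : ℕ} {B : Fin m → Type*}, (∀ i, FormalSum (B i)) → FormalSum (∀ i, B i)
  | 0, _, _ => [(1, fun i => i.elim0)]
  | _ + 1, _, T => (T 0).bind fun b => (choices fun i => T i.succ).bind fun l => [(1, Fin.cons b l)]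

theorem map_linComb_choices {k : Type*} [CommRing k] [Module k W] {m : ℕ}
    {B : Fin m → Type*} {U : Fin m → Type*} [∀ i, AddCommGroup (U i)] [∀ i, Module k (U i)]
    (φ : MultilinearMap k U W) (ev : ∀ i, B i → U i) (T : ∀ i, FormalSum (B i)) :
    φ (fun i => linComb (ev i) (T i)) = linComb (fun l => φ fun i => ev i (l i)) (choices T) := by
  induction m with
  | zero =>
    simp only [choices, linComb_singleton, one_smul]
    exact congrArg φ (funext fun i => i.elim0)
  | succ m ih =>
    have hcurry : ∀ u : ∀ i, U i, φ u = φ.curryLeft (u 0) fun i => u i.succ := fun u => by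
      rw [MultilinearMap.curryLeft_apply]
      exact congrArg φ (Fin.cons_self_tail u).symm
    simp only [choices, linComb_bind, linComb_singleton, one_smul]
    rw [hcurry, map_linComb]
    let evalTail : MultilinearMap k (fun i : Fin m => U i.succ) W →+ W :=
      AddMonoidHom.mk' (fun ψ => ψ fun i => linComb (ev i.succ) (T i.succ)) fun _ _ => rfl
    refine (map_linComb evalTail _ _).trans (congrArg (linComb · (T 0)) (funext fun b => ?_))
    refine (ih (φ.curryLeft (ev 0 b)) (fun i => ev i.succ) fun i => T i.succ).trans ?_
    simp only [hcurry (fun i => ev i _), Fin.cons_zero, Fin.cons_succ]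

/-- A search tree of terms, used to collect the coefficients of a formal sum by computation. -/
inductive Coeffs (A : Type*)
  | nil : Coeffs A
  | node (l : Coeffs A) (key : ℕ) (a : A) (c : ℤ) (r : Coeffs A) : Coeffs A

namespace Coeffs

/-- The value of the collected sum. -/
def value (f : A → V) : Coeffs A → V
  | nil => 0
  | node l _ a c r => value f l + c • f a + value f r

/-- Adds the term `(c, a)`. The tree is searched by `key`, which need not be injective. -/
def insert [DecidableEq A] (key : ℕ) (a : A) (c : ℤ) : Coeffs A → Coeffs A
  | nil => node nil key a c nil
  | node l key' a' c' r =>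
    bif Nat.blt key key' then node (insert key a c l) key' a' c' r
    else bif Nat.blt key' key then node l key' a' c' (insert key a c r)
    else if a = a' then node l key' a' (c' + c) r
    else node (insert key a c l) key' a' c' r

theorem value_insert [DecidableEq A] (f : A → V) (key : ℕ) (a : A) (c : ℤ) (t : Coeffs A) :
    value f (insert key a c t) = c • f a + value f t := by
  induction t with
  | nil => simp [insert, value]
  | node l key' a' c' r ihl ihr =>
    rw [insert]
    cases Nat.blt key key'
    · cases Nat.blt key' key
      · by_cases h : a = a'
        · subst h; simp only [cond_false, if_true, value, add_smul]; abel
        · simp only [cond_false, if_neg h, value, ihl]; abel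
      · simp only [cond_false, cond_true, value, ihr]; abel
    · simp only [cond_true, value, ihl]; abel

/-- All collected coefficients vanish. -/
def vanishes : Coeffs A → Bool
  | nil => true
  | node l _ _ c r => decide (c = 0) && (vanishes l && vanishes r)

theorem value_eq_zero (f : A → V) {t : Coeffs A} (h : vanishes t = true) : value f t = 0 := by
  induction t with
  | nil => rfl
  | node l key a c r ihl ihr =>
    simp only [vanishes, Bool.and_eq_true, decide_eq_true_eq] at h
    obtain ⟨rfl, hl, hr⟩ := h
    rw [value, ihl hl, ihr hr, zero_smul, add_zero, add_zero]

/-- Adds the terms of `s • L`. -/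
def collect [DecidableEq A] (key : A → ℕ) (s : ℤ) (L : FormalSum A) (t : Coeffs A) : Coeffs A :=
  L.foldl (fun t q => insert (key q.2) q.2 (s * q.1) t) t

theorem value_collect [DecidableEq A] (f : A → V) (key : A → ℕ) (s : ℤ) (L : FormalSum A)
    (t : Coeffs A) : value f (collect key s L t) = s • linComb f L + value f t := by
  induction L generalizing t with
  | nil => simp [collect]
  | cons q L ih =>
    rw [collect, List.foldl_cons, ← collect, ih, value_insert, linComb_cons, smul_add, mul_smul]
    abel

end Coeffs

/-- Two formal sums have equal coefficients, decided by collecting the terms of their difference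
in a search tree. -/
def sameTerms [DecidableEq A] (key : A → ℕ) (L L' : FormalSum A) : Bool :=
  (Coeffs.collect key (-1) L' (Coeffs.collect key 1 L .nil)).vanishes

theorem linComb_eq_of_sameTerms [DecidableEq A] (f : A → V) (key : A → ℕ) {L L' : FormalSum A}
    (h : sameTerms key L L' = true) : linComb f L = linComb f L' := by
  have hzero := Coeffs.value_eq_zero f h
  rw [Coeffs.value_collect, Coeffs.value_collect, Coeffs.value, one_smul, neg_one_smul,
    add_zero, neg_add_eq_zero] at hzero
  exact hzero.symm

end FormalSum

section Corolla

variable {A B : Type}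

/-- A generator of `LieD[3]` of some arity and degree. -/
abbrev Gen := Σ (n : ℕ) (r : ℤ), LieGen n r

/-- A generator of `LieD[3]` whose inputs carry labels in `A`. With corollas as labels, this is a
two-level tree. -/
structure Corolla (A : Type) where
  gen : Gen
  lab : Fin gen.1 → A

/-- The position of a generator in the list of all generators. -/
def idx : ∀ {n : ℕ} {r : ℤ}, LieGen n r → ℕ
  | _, _, .l1 => 0
  | _, _, .l2 => 1
  | _, _, .l21 => 2
  | _, _, .l211 => 3
  | _, _, .l2111 => 4
  | _, _, .l3 => 5
  | _, _, .l31 => 6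
  | _, _, .l32 => 7
  | _, _, .l311 => 8
  | _, _, .l312 => 9
  | _, _, .l322 => 10
  | _, _, .l4 => 11
  | _, _, .l41 => 12
  | _, _, .l42 => 13
  | _, _, .l43 => 14
  | _, _, .l5 => 15

theorem idx_injective : Function.Injective fun g : Gen => idx g.2.2 := by
  rintro ⟨_, _, g⟩ ⟨_, _, g'⟩ h
  cases g <;> cases g' <;> first | rfl | cases h

namespace Corolla

/-- The corolla with its labels changed by `f`. -/
def map (f : A → B) (c : Corolla A) : Corolla B := ⟨c.gen, fun i => f (c.lab i)⟩

/-- An encoding of corollas for which equality is decided by comparing numbers and lists. -/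
def code (c : Corolla A) : ℕ × List A := (idx c.gen.2.2, List.ofFn c.lab)

theorem code_injective : Function.Injective (code (A := A)) := by
  rintro ⟨g, l⟩ ⟨g', l'⟩ h
  obtain ⟨hg, hl⟩ := Prod.mk.inj h
  obtain rfl : g = g' := idx_injective hg
  exact congrArg (mk g) (List.ofFn_injective hl)

instance [DecidableEq A] : DecidableEq (Corolla A) := fun _ _ =>
  decidable_of_iff _ code_injective.eq_iff

/-- A search key for corollas, where `f` adds the key of a label to the key `a`. -/
def key (f : ℕ → A → ℕ) (a : ℕ) (c : Corolla A) : ℕ :=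
  (List.ofFn c.lab).foldl f (16 * a + idx c.gen.2.2)

end Corolla

/-- A search key for two-level trees. -/
def treeKey {n : ℕ} : Corolla (Corolla (Fin n)) → ℕ :=
  Corolla.key (Corolla.key fun a t => 16 * a + t) 0

/-- A search key for three-level trees. -/
def treeKey₃ {n : ℕ} : Corolla (Corolla (Corolla (Fin n))) → ℕ :=
  Corolla.key (Corolla.key (Corolla.key fun a t => 16 * a + t)) 0

end Corolla

section Monomial

variable {n m : ℕ} {r p : ℤ}

/-- The data of an element `(μ ∘ (ν_1, …, ν_m)) ^ σ` of `LieD[3] ∘ LieD[3]`, for generators `μ` and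
`ν_i`. -/
structure Monomial (n : ℕ) (r : ℤ) where
  {m : ℕ}
  {p : ℤ}
  top : LieGen m p
  bot : Fin m → Gen
  perm : Perm (Fin n)
  arity : ∑ i, (bot i).1 = n := by decide
  deg : p + ∑ i, (bot i).2.1 = r := by decide

namespace Monomial

variable (x : Monomial n r)

/-- The labels of the inputs of the bottom generators. -/
def lab : (Σ i, Fin (x.bot i).1) ≃ Fin n :=
  (finSigmaFinEquiv.trans (finCongr x.arity)).trans x.perm.symm

/-- The bottom corollas. -/
def leaf (i : Fin x.m) : Corolla (Fin n) := ⟨x.bot i, fun t => x.lab ⟨i, t⟩⟩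

/-- The two-level tree of a monomial. -/
def tree : Corolla (Corolla (Fin n)) := ⟨S x.top, x.leaf⟩

/-- The action of `S_n` on monomials. -/
def act (σ : Perm (Fin n)) : Monomial n r := { x with perm := x.perm * σ }

end Monomial

/-- The differential of a generator as a formal sum. -/
def diffTerms : ∀ {n : ℕ} {r : ℤ}, LieGen n r → FormalSum (LieGen n (r - 1) × Perm (Fin n))
  | _, _, .l1 | _, _, .l2 | _, _, .l3 | _, _, .l4 | _, _, .l5 => []
  | _, _, .l21 => [(-1, l2, 1), (-1, l2, cyc [1, 2])]
  | _, _, .l211 => [(-1, l21, 1), (1, l21, cyc [1, 2])]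
  | _, _, .l2111 => [(-1, l211, 1), (-1, l211, cyc [1, 2])]
  | _, _, .l31 => [(-1, l3, 1), (-1, l3, cyc [1, 2])]
  | _, _, .l32 => [(-1, l3, 1), (-1, l3, cyc [2, 3])]
  | _, _, .l311 => [(-1, l31, 1), (1, l31, cyc [1, 2])]
  | _, _, .l312 => [(1, l31, 1), (1, l31, cyc [2, 3]), (1, l31, cyc [1, 3, 2]),
      (-1, l32, 1), (-1, l32, cyc [1, 2]), (-1, l32, cyc [1, 2, 3])]
  | _, _, .l322 => [(-1, l32, 1), (1, l32, cyc [2, 3])]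
  | _, _, .l41 => [(-1, l4, 1), (-1, l4, cyc [1, 2])]
  | _, _, .l42 => [(-1, l4, 1), (-1, l4, cyc [2, 3])]
  | _, _, .l43 => [(-1, l4, 1), (-1, l4, cyc [3, 4])]

/-- The reduced decomposition of a generator as a formal sum. -/
def redTerms : ∀ {n : ℕ} {r : ℤ}, LieGen n r → FormalSum (Monomial n r)
  | _, _, .l1 | _, _, .l2 | _, _, .l21 | _, _, .l211 | _, _, .l2111 => []
  | _, _, .l3 => [(-1, .mk .l2 ![S .l2, S .l1] 1), (1, .mk .l2 ![S .l1, S .l2] 1),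
      (-1, .mk .l2 ![S .l1, S .l2] (cyc [1, 2]))]
  | _, _, .l31 => [(1, .mk .l2 ![S .l21, S .l1] 1)]
  | _, _, .l32 => [(-1, .mk .l21 ![S .l2, S .l1] 1), (-1, .mk .l2 ![S .l1, S .l21] 1),
      (-1, .mk .l21 ![S .l1, S .l2] (cyc [1, 2]))]
  | _, _, .l311 => [(-1, .mk .l2 ![S .l211, S .l1] 1)]
  | _, _, .l312 => [(-1, .mk .l21 ![S .l21, S .l1] 1), (-1, .mk .l21 ![S .l1, S .l21] 1),
      (-1, .mk .l21 ![S .l1, S .l21] (cyc [1, 2])), (1, .mk .l211 ![S .l1, S .l2] (cyc [1, 3, 2]))]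
  | _, _, .l322 => [(-1, .mk .l211 ![S .l2, S .l1] 1), (1, .mk .l2 ![S .l1, S .l211] 1),
      (-1, .mk .l211 ![S .l1, S .l2] (cyc [1, 2]))]
  | _, _, .l4 => [(1, .mk .l2 ![S .l3, S .l1] 1), (1, .mk .l2 ![S .l1, S .l3] 1),
      (-1, .mk .l2 ![S .l1, S .l3] (cyc [1, 2])), (1, .mk .l2 ![S .l1, S .l3] (cyc [1, 2, 3])),
      (-1, .mk .l2 ![S .l2, S .l2] 1), (1, .mk .l2 ![S .l2, S .l2] (cyc [2, 3])),
      (-1, .mk .l2 ![S .l2, S .l2] (cyc [1, 3, 2])), (1, .mk .l3 ![S .l2, S .l1, S .l1] 1),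
      (-1, .mk .l3 ![S .l1, S .l2, S .l1] 1), (1, .mk .l3 ![S .l1, S .l2, S .l1] (cyc [1, 2])),
      (1, .mk .l3 ![S .l1, S .l1, S .l2] 1), (-1, .mk .l3 ![S .l1, S .l1, S .l2] (cyc [2, 3])),
      (1, .mk .l3 ![S .l1, S .l1, S .l2] (cyc [1, 3, 2]))]
  | _, _, .l41 => [(-1, .mk .l2 ![S .l31, S .l1] 1), (-1, .mk .l2 ![S .l1, S .l31] (cyc [1, 2, 3])),
      (1, .mk .l2 ![S .l21, S .l2] 1), (1, .mk .l3 ![S .l21, S .l1, S .l1] 1),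
      (1, .mk .l31 ![S .l1, S .l1, S .l2] 1)]
  | _, _, .l42 => [(-1, .mk .l2 ![S .l32, S .l1] 1), (-1, .mk .l2 ![S .l1, S .l31] 1),
      (1, .mk .l2 ![S .l21, S .l2] (cyc [1, 3, 2])), (1, .mk .l31 ![S .l2, S .l1, S .l1] 1),
      (1, .mk .l31 ![S .l1, S .l2, S .l1] (cyc [1, 2])), (-1, .mk .l3 ![S .l1, S .l21, S .l1] 1),
      (1, .mk .l31 ![S .l1, S .l1, S .l2] (cyc [1, 3, 2]))]
  | _, _, .l43 => [(1, .mk .l21 ![S .l1, S .l3] (cyc [1, 2, 3])), (-1, .mk .l2 ![S .l1, S .l32] 1),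
      (1, .mk .l2 ![S .l1, S .l32] (cyc [1, 2])), (1, .mk .l21 ![S .l3, S .l1] 1),
      (-1, .mk .l2 ![S .l2, S .l21] 1), (-1, .mk .l21 ![S .l2, S .l2] (cyc [1, 3, 2])),
      (1, .mk .l21 ![S .l2, S .l2] (cyc [2, 3])), (1, .mk .l32 ![S .l2, S .l1, S .l1] 1),
      (-1, .mk .l32 ![S .l1, S .l1, S .l2] (cyc [2, 3])),
      (1, .mk .l32 ![S .l1, S .l1, S .l2] (cyc [1, 3, 2])), (1, .mk .l3 ![S .l1, S .l1, S .l21] 1),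
      (-1, .mk .l32 ![S .l1, S .l2, S .l1] 1), (1, .mk .l32 ![S .l1, S .l2, S .l1] (cyc [1, 2]))]
  | _, _, .l5 => [(-1, .mk .l2 ![S .l4, S .l1] 1), (1, .mk .l2 ![S .l3, S .l2] 1),
      (-1, .mk .l2 ![S .l3, S .l2] (cyc [3, 4])), (1, .mk .l2 ![S .l3, S .l2] (cyc [2, 4, 3])),
      (-1, .mk .l2 ![S .l3, S .l2] (cyc [1, 4, 3, 2])), (-1, .mk .l2 ![S .l2, S .l3] 1),
      (1, .mk .l2 ![S .l2, S .l3] (cyc [2, 3])), (-1, .mk .l2 ![S .l2, S .l3] (cyc [2, 3, 4])),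
      (-1, .mk .l2 ![S .l2, S .l3] (cyc [1, 3, 2])),
      (1, .mk .l2 ![S .l2, S .l3] (cyc [1, 3, 4, 2])),
      (-1, .mk .l2 ![S .l2, S .l3] (cyc [1, 3] * cyc [2, 4])), (1, .mk .l2 ![S .l1, S .l4] 1),
      (-1, .mk .l2 ![S .l1, S .l4] (cyc [1, 2])), (1, .mk .l2 ![S .l1, S .l4] (cyc [1, 2, 3])),
      (-1, .mk .l2 ![S .l1, S .l4] (cyc [1, 2, 3, 4])), (1, .mk .l3 ![S .l3, S .l1, S .l1] 1),
      (-1, .mk .l3 ![S .l2, S .l2, S .l1] 1), (1, .mk .l3 ![S .l2, S .l2, S .l1] (cyc [2, 3])),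
      (-1, .mk .l3 ![S .l2, S .l2, S .l1] (cyc [1, 3, 2])), (1, .mk .l3 ![S .l2, S .l1, S .l2] 1),
      (1, .mk .l3 ![S .l2, S .l1, S .l2] (cyc [2, 4, 3])),
      (-1, .mk .l3 ![S .l2, S .l1, S .l2] (cyc [3, 4])),
      (-1, .mk .l3 ![S .l2, S .l1, S .l2] (cyc [1, 4, 3, 2])),
      (1, .mk .l3 ![S .l1, S .l3, S .l1] 1), (-1, .mk .l3 ![S .l1, S .l3, S .l1] (cyc [1, 2])),
      (1, .mk .l3 ![S .l1, S .l3, S .l1] (cyc [1, 2, 3])), (-1, .mk .l3 ![S .l1, S .l2, S .l2] 1),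
      (1, .mk .l3 ![S .l1, S .l2, S .l2] (cyc [3, 4])),
      (-1, .mk .l3 ![S .l1, S .l2, S .l2] (cyc [2, 4, 3])),
      (1, .mk .l3 ![S .l1, S .l2, S .l2] (cyc [1, 2])),
      (-1, .mk .l3 ![S .l1, S .l2, S .l2] (cyc [1, 2] * cyc [3, 4])),
      (1, .mk .l3 ![S .l1, S .l2, S .l2] (cyc [1, 2, 4, 3])),
      (-1, .mk .l3 ![S .l1, S .l2, S .l2] (cyc [1, 4, 3])),
      (1, .mk .l3 ![S .l1, S .l2, S .l2] (cyc [1, 4, 3, 2])), (1, .mk .l3 ![S .l1, S .l1, S .l3] 1),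
      (-1, .mk .l3 ![S .l1, S .l1, S .l3] (cyc [2, 3])),
      (1, .mk .l3 ![S .l1, S .l1, S .l3] (cyc [2, 3, 4])),
      (1, .mk .l3 ![S .l1, S .l1, S .l3] (cyc [1, 3, 2])),
      (-1, .mk .l3 ![S .l1, S .l1, S .l3] (cyc [1, 3, 4, 2])),
      (1, .mk .l3 ![S .l1, S .l1, S .l3] (cyc [1, 3] * cyc [2, 4])),
      (-1, .mk .l4 ![S .l2, S .l1, S .l1, S .l1] 1), (1, .mk .l4 ![S .l1, S .l2, S .l1, S .l1] 1),
      (-1, .mk .l4 ![S .l1, S .l2, S .l1, S .l1] (cyc [1, 2])),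
      (-1, .mk .l4 ![S .l1, S .l1, S .l2, S .l1] 1),
      (1, .mk .l4 ![S .l1, S .l1, S .l2, S .l1] (cyc [2, 3])),
      (-1, .mk .l4 ![S .l1, S .l1, S .l2, S .l1] (cyc [1, 3, 2])),
      (1, .mk .l4 ![S .l1, S .l1, S .l1, S .l2] 1),
      (-1, .mk .l4 ![S .l1, S .l1, S .l1, S .l2] (cyc [3, 4])),
      (1, .mk .l4 ![S .l1, S .l1, S .l1, S .l2] (cyc [2, 4, 3])),
      (-1, .mk .l4 ![S .l1, S .l1, S .l1, S .l2] (cyc [1, 4, 3, 2]))]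

/-- The monomial `1 ∘ (g)`. -/
def Monomial.oneComp (g : LieGen n r) : Monomial n r :=
  ⟨l1, fun _ => S g, 1, by simp [S], by simp [S]⟩

/-- The monomial `g ∘ (1, …, 1)`. -/
def Monomial.compOne (g : LieGen n r) : Monomial n r :=
  ⟨g, fun _ => S l1, 1, by simp [S], by simp [S]⟩

/-- The full decomposition of a generator as a formal sum. -/
def decompTerms : ∀ {n : ℕ} {r : ℤ}, LieGen n r → FormalSum (Monomial n r)
  | _, _, .l1 => [(1, .oneComp l1)]
  | _, _, g => (1, .oneComp g) :: (redTerms g ++ [(1, .compOne g)])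

theorem decompTerms_of_arity_ne_one (g : LieGen n r) (h : n ≠ 1) :
    decompTerms g = (1, .oneComp g) :: (redTerms g ++ [(1, .compOne g)]) := by
  cases g
  case l1 => exact absurd rfl h
  all_goals rfl

namespace Monomial

variable (x : Monomial n r)

/-- The terms of the differential of `x` in which the top generator is differentiated. -/
def diffTop : FormalSum (Corolla (Corolla (Fin n))) :=
  (diffTerms x.top).bind fun (g, σ) =>
    [(koszulSign (fun i => (x.bot i).2.1) (fun i => i) (fun i => σ i),
      ⟨S g, x.leaf ∘ σ.symm⟩)]

/-- The terms of the differential of `x` in which the `i`-th bottom generator is differentiated. -/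
def diffBot (i : Fin x.m) : FormalSum (Corolla (Corolla (Fin n))) :=
  (diffTerms (x.bot i).2.2).bind fun (g, σ) =>
    [(prefixSign x.p (fun i => (x.bot i).2.1) i,
      ⟨S x.top, Function.update x.leaf i ⟨S g, (x.leaf i).lab ∘ σ.symm⟩⟩)]

/-- The differential of `x`. -/
def diff : FormalSum (Corolla (Corolla (Fin n))) :=
  x.diffTop ++ (List.finRange x.m).flatMap x.diffBot

/-- The image of `x` under `Δ ∘ id`, reassociated. -/
def decompTop : FormalSum (Corolla (Corolla (Corolla (Fin n)))) :=
  (decompTerms x.top).bind fun z =>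
    [(assocSign z.lab (fun i => (z.bot i).2.1) (fun j => (x.bot j).2.1),
      z.tree.map (Corolla.map x.leaf))]

/-- The image of `x` under `id ∘ Δ`. -/
def decompBots : FormalSum (Corolla (Corolla (Corolla (Fin n)))) :=
  (choices fun i => decompTerms (x.bot i).2.2).bind fun z =>
    [(1, ⟨S x.top, fun i => (z i).tree.map (Corolla.map (x.leaf i).lab)⟩)]

end Monomial

/-- The decomposition of the differential of a generator. -/
def diffDecomp (g : LieGen n r) : FormalSum (Corolla (Corolla (Fin n))) :=
  (diffTerms g).bind fun (g', σ) => (decompTerms g').bind fun x => [(1, (x.act σ).tree)]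

theorem sameTerms_diff (g : LieGen n r) :
    sameTerms treeKey (diffDecomp g) ((decompTerms g).bind Monomial.diff) = true := by
  cases g <;> decide +kernel

theorem sameTerms_coassoc (g : LieGen n r) :
    sameTerms treeKey₃ ((decompTerms g).bind Monomial.decompTop)
      ((decompTerms g).bind Monomial.decompBots) = true := by
  cases g <;> decide +kernel

end Monomial

section Evaluation

variable {k : Type u} [CommRing k] {A : Type} {n m : ℕ} {r p : ℤ}

theorem dGen_eq_linComb (g : LieGen n r) :
    (dGen g : FreeX k n (r - 1)) = linComb (fun x => el x.1 x.2) (diffTerms g) := by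
  cases g <;> simp only [dGen, diffTerms, linComb_nil, linComb_cons, neg_smul, one_smul,
    add_zero] <;> abel

variable (k) in
/-- The element of `LieD[3] ∘ LieD[3]` described by a monomial. -/
noncomputable def Monomial.value (x : Monomial n r) : CompX (LieD3 k) (LieD3 k) n r :=
  tm x.top x.bot x.perm x.arity x.deg

theorem redDecomp_eq_linComb (g : LieGen n r) :
    (redDecomp g : CompX (LieD3 k) (LieD3 k) n r) = linComb (Monomial.value k) (redTerms g) := by
  cases g <;> simp only [redDecomp, redTerms, linComb_nil, linComb_cons, Monomial.value, neg_smul,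
    one_smul, add_zero] <;> abel

theorem decompGen_eq_linComb (g : LieGen n r) :
    (decompGen g : CompX (LieD3 k) (LieD3 k) n r) = linComb (Monomial.value k) (decompTerms g) := by
  cases g <;> simp only [decompGen, decompTerms, redDecomp_eq_linComb, linComb_append, linComb_nil,
    linComb_cons, Monomial.value, Monomial.oneComp, Monomial.compOne, Matrix.vec_single_eq_const,
    one_smul, add_zero, add_assoc]

theorem el_eq_act (g : LieGen n r) (σ : Perm (Fin n)) :
    (el g σ : FreeX k n r) = freeAct σ (el g 1) := by
  rw [freeAct_el, one_mul]

theorem d_el (g : LieGen n r) :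
    (LieD3 k).d (el g 1 : FreeX k n r) = linComb (fun x => el x.1 x.2) (diffTerms g) :=
  (freeD_el g 1).trans <| (freeAct_one _).trans <| dGen_eq_linComb g

theorem decomp_el (g : LieGen n r) :
    decomp.map (el g 1 : FreeX k n r) = linComb (Monomial.value k) (decompTerms g) :=
  (decompLin_el g 1).trans <| (CompX.act_one _).trans <| decompGen_eq_linComb g

namespace Corolla

variable (k) in
/-- The entry of a corolla of a generator. -/
noncomputable def entry (c : Corolla A) : Entry (LieD3 k) A :=
  ⟨c.gen.1, c.gen.2.1, el c.gen.2.2 1, c.lab⟩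

variable (k) in
/-- The entry of a two-level tree. -/
noncomputable def treeEntry (c : Corolla (Corolla A)) : Entry ((LieD3 k).comp (LieD3 k)) A :=
  Entry.comp (el c.gen.2.2 1 : FreeX k _ _) fun t => (c.lab t).entry k

variable (k) in
/-- The element of `LieD[3] ∘ LieD[3]` given by a two-level tree. -/
noncomputable def value (r : ℤ) (t : Corolla (Corolla (Fin n))) :
    CompX (LieD3 k) (LieD3 k) n r :=
  graft r (fun i => (t.lab i).entry k) (el t.gen.2.2 1 : FreeX k _ _)

variable (k) in
/-- The element of `LieD[3] ∘ (LieD[3] ∘ LieD[3])` given by a three-level tree. -/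
noncomputable def value₃ (r : ℤ) (t : Corolla (Corolla (Corolla (Fin n)))) :
    CompX (LieD3 k) ((LieD3 k).comp (LieD3 k)) n r :=
  graft r (fun i => (t.lab i).treeEntry k) (el t.gen.2.2 1 : FreeX k _ _)

theorem rel_entry (c : Corolla A) (g : LieGen c.gen.1 r) (σ : Perm (Fin c.gen.1)) :
    Entry.Rel ⟨c.gen.1, r, (el g σ : FreeX k _ _), c.lab⟩
      (entry k ⟨S g, c.lab ∘ σ.symm⟩) :=
  ⟨σ, (el g 1 : FreeX k _ _), (el_eq_act g σ).symm, rfl⟩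

theorem graft_update_diff (y : Fin m → Corolla (Fin n)) (i : Fin m) (x : (LieD3 k).X m p) :
    graft r (Function.update (fun j => (y j).entry k) i ((y i).entry k).diff) x =
      linComb (fun g => graft r
        (fun j => (Function.update y i ⟨S g.1, (y i).lab ∘ g.2.symm⟩ j).entry k) x)
        (diffTerms (y i).gen.2.2) := by
  rw [Entry.diff, entry, d_el, ← IsLinearMap.mk'_apply (isLinearMap_graft_update _ i _ _),
    map_linComb]
  refine congrArg (linComb · _) (funext fun g => graft_congr_rel (fun j => ?_) _)
  obtain rfl | hj := eq_or_ne j i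
  · simpa only [Function.update_self] using rel_entry (y j) g.1 g.2
  · simpa only [Function.update_of_ne hj] using Entry.Rel.refl _

end Corolla

namespace Monomial

variable (x : Monomial n r)

theorem value_eq_node :
    x.value k = node (M := LieD3 k) (N := LieD3 k) (el x.top 1) x.lab x.deg
      fun i => el (x.bot i).2.2 1 :=
  act_node ..

theorem value_eq_value_tree : x.value k = x.tree.value k r :=
  x.value_eq_node.trans (node_eq_graft ..)

theorem value_act (σ : Perm (Fin n)) : CompX.act σ (x.value k) = (x.act σ).value k :=
  (CompX.act_mul _ _ _).symm

theorem graft_d_top :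
    graft (r - 1) (fun i => (x.leaf i).entry k) ((LieD3 k).d (el x.top 1 : FreeX k _ _)) =
      linComb (Corolla.value k (r - 1)) x.diffTop := by
  rw [d_el, map_linComb, diffTop, linComb_bind]
  congr 1
  funext ⟨g, σ⟩
  rw [linComb_singleton, el_eq_act]
  exact graft_act (N := LieD3 k) _ σ _

theorem graft_d_bot (i : Fin x.m) :
    (prefixSign x.p (fun i => (x.bot i).2.1) i : ℤ) •
      graft (r - 1) (Function.update (fun j => (x.leaf j).entry k) i ((x.leaf i).entry k).diff)
        (el x.top 1 : FreeX k _ _) =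
    linComb (Corolla.value k (r - 1)) (x.diffBot i) := by
  rw [Corolla.graft_update_diff, diffBot, linComb_bind, ← zsmulAddGroupHom_apply, map_linComb]
  refine congrArg (linComb · _) (funext fun g => ?_)
  rw [linComb_singleton]
  rfl

theorem d_value : CompX.d (x.value k) = linComb (Corolla.value k (r - 1)) x.diff := by
  rw [value_eq_node, d_node_eq_graft, diff, linComb_append, linComb_flatMap_finRange, ← graft_d_top]
  exact congrArg _ (Finset.sum_congr rfl fun i _ => x.graft_d_bot i)

theorem associator_decomp_id_value :
    associator (LieD3 k) (LieD3 k) (LieD3 k) ((decomp.comp (SHom.id _)).map (x.value k)) =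
      linComb (Corolla.value₃ k r) x.decompTop := by
  rw [value_eq_node]
  refine (congrArg _ (map_node ..)).trans ?_
  rw [decomp_el]
  let φ := associator (LieD3 k) (LieD3 k) (LieD3 k) ∘ₗ
    nodeTop (M := (LieD3 k).comp (LieD3 k)) x.lab x.deg fun i => (el (x.bot i).2.2 1 : FreeX k _ _)
  refine (map_linComb φ _ _).trans ?_
  rw [decompTop, linComb_bind]
  refine congrArg (linComb · _) (funext fun z => ?_)
  rw [linComb_singleton, value_eq_node]
  exact associator_node_node ..

theorem id_decomp_value :
    ((SHom.id (LieD3 k)).comp decomp).map (x.value k) =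
      linComb (Corolla.value₃ k r) x.decompBots := by
  rw [value_eq_node]
  refine (map_node ..).trans ?_
  refine (congrArg _ (funext fun i => decomp_el (x.bot i).2.2)).trans ?_
  refine (map_linComb_choices (node (M := LieD3 k) (N := (LieD3 k).comp (LieD3 k)) (el x.top 1)
    x.lab x.deg) (fun i => value k) _).trans ?_
  rw [decompBots, linComb_bind]
  refine congrArg (linComb · _) (funext fun z => ?_)
  rw [linComb_singleton, one_smul]
  simp only [value_eq_node]
  exact node_node ..

end Monomial

end Evaluation

section Unitors

variable {k : Type u} [CommRing k] (M : DGSMod k) {n : ℕ} {r : ℤ}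

theorem isLinearMap_leftUnitorInv : IsLinearMap k (leftUnitorInv M : M.X n r → _) := by
  have hconst (z w : M.X n r) : (fun _ : Fin 1 => z) = Function.update (fun _ => w) 0 z :=
    funext fun i => by rw [Subsingleton.elim i 0, Function.update_self]
  refine ⟨fun x y => ?_, fun c x => ?_⟩ <;> unfold leftUnitorInv
  · rw [hconst (x + y) x, hconst y x, MultilinearMap.map_update_add, ← hconst x x, ← hconst y x]
  · rw [hconst (c • x) x, MultilinearMap.map_update_smul, ← hconst x x]

theorem isLinearMap_rightUnitorInv : IsLinearMap k (rightUnitorInv M : M.X n r → _) :=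
  (nodeTop (N := unit k) (ar := fun _ => 1) (q := fun _ => 0)
    (Equiv.sigmaUnique (Fin n) fun _ => Fin 1) (by simp) fun _ => unit.one).isLinear

theorem leftUnitorInv_act (σ : Perm (Fin n)) (x : M.X n r) :
    leftUnitorInv M (M.act σ x) = CompX.act σ (leftUnitorInv M x) := by
  unfold leftUnitorInv
  rw [act_node]
  refine (node_bot_act (M := unit k) (N := M) _ _ _ (fun _ => x) fun _ => σ).trans ?_
  refine node_lab_congr _ _ _ ?_
  rintro ⟨i, t⟩
  obtain rfl : i = default := Subsingleton.elim _ _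
  rfl

theorem rightUnitorInv_act (σ : Perm (Fin n)) (x : M.X n r) :
    rightUnitorInv M (M.act σ x) = CompX.act σ (rightUnitorInv M x) := by
  unfold rightUnitorInv
  rw [act_node, node_top_act]
  have hsign : koszulSign (fun _ : Fin n => (0 : ℤ)) (fun i => i) (fun i => σ i) = 1 := by
    simp [koszulSign]
  rw [hsign, Units.val_one, Int.cast_one, one_smul]
  exact node_lab_congr _ _ _ fun _ => rfl

variable {M}

theorem unit_eq_zero (h : n ≠ 1) (x : (unit k).X n r) : x = 0 := by
  have hbot : (if n = 1 ∧ r = 0 then ⊤ else ⊥ : Submodule k k) = ⊥ := if_neg fun h' => h h'.1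
  exact Subtype.ext ((Submodule.mem_bot k).1 (hbot.le x.2))

theorem associator_act {N P : DGSMod k} (σ : Perm (Fin n)) (x : ((M.comp N).comp P).X n r) :
    associator M N P (CompX.act σ x) = CompX.act σ (associator M N P x) := by
  suffices h : associator M N P ∘ₗ CompX.act σ =
      (CompX.act σ ∘ₗ associator M N P : ((M.comp N).comp P).X n r →ₗ[k] _) from
    LinearMap.congr_fun h x
  refine hom_ext fun ⟨m, p, y, a, q, ρ, lab, h⟩ => ?_
  rw [LinearMap.comp_apply, LinearMap.comp_apply, act_mk]
  refine (lift_mk _ assocInner_respects _).trans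
    (Eq.trans ?_ (congrArg (CompX.act σ) (lift_mk _ assocInner_respects _).symm))
  suffices h' : assocInner (lab.trans σ.symm) h ρ = CompX.act σ ∘ₗ
      (assocInner lab h ρ : CompX M N m p →ₗ[k] CompX M (N.comp P) n r) from
    LinearMap.congr_fun h' y
  refine hom_ext fun s => ?_
  rw [LinearMap.comp_apply, assocInner, assocInner, lift_mk, lift_mk, assocTree, assocTree,
    map_smul, assocNode, assocNode, act_node]
  rfl

end Unitors

section Generators

variable {k : Type u} [CommRing k] {n : ℕ} {r : ℤ}

namespace Monomial

variable {x : Monomial n r}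

theorem counit_id_value_eq_zero (h : x.m ≠ 1) :
    (counit.comp (SHom.id (LieD3 k))).map (x.value k) = 0 := by
  rw [value_eq_node]
  refine (map_node ..).trans ?_
  rw [unit_eq_zero h (counit.map _), node_zero]

theorem id_counit_value_eq_zero {i : Fin x.m} (h : (x.bot i).1 ≠ 1) :
    ((SHom.id (LieD3 k)).comp counit).map (x.value k) = 0 := by
  rw [value_eq_node]
  exact (map_node ..).trans (MultilinearMap.map_coord_zero _ i (unit_eq_zero h _))

end Monomial

theorem redTerms_top_arity_ne_one (g : LieGen n r) : ∀ x ∈ redTerms g, x.2.m ≠ 1 := by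
  cases g <;> decide

theorem redTerms_exists_bot_arity_ne_one (g : LieGen n r) :
    ∀ x ∈ redTerms g, ∃ i, (x.2.bot i).1 ≠ 1 := by
  cases g <;> decide

theorem counit_l1 : counit.map (el .l1 1 : FreeX k 1 0) = unit.one := by
  simp [counit, el, counitGen]

theorem counit_d_el (g : LieGen n r) :
    counit.map ((LieD3 k).d (el g 1 : FreeX k n r)) = 0 := by
  rw [d_el]
  cases g
  case l1 => exact map_zero _
  all_goals exact unit_eq_zero (by decide) _

namespace Monomial

theorem counit_id_value_oneComp (g : LieGen n r) :
    (counit.comp (SHom.id (LieD3 k))).map ((oneComp g).value k) = leftUnitorInv _ (el g 1) := by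
  rw [value_eq_node]
  refine (map_node ..).trans ?_
  rw [oneComp, counit_l1]
  refine node_lab_congr _ _ _ ?_
  rintro ⟨i, t⟩
  obtain rfl : i = default := Subsingleton.elim _ _
  exact Fin.ext ((finSigmaFinEquiv_apply _).trans (zero_add _))

theorem id_counit_value_compOne (g : LieGen n r) :
    ((SHom.id (LieD3 k)).comp counit).map ((compOne g).value k) = rightUnitorInv _ (el g 1) := by
  rw [value_eq_node]
  refine (map_node ..).trans ((congrArg _ (funext fun _ => counit_l1)).trans ?_)
  refine node_lab_congr _ _ _ ?_
  rintro ⟨i, t : Fin 1⟩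
  obtain rfl : t = 0 := Subsingleton.elim _ _
  refine Fin.ext ((finSigmaFinEquiv_apply _).trans ?_)
  simp only [compOne, S, Fin.isValue, Finset.sum_const, Finset.card_univ, Fintype.card_fin,
    smul_eq_mul, mul_one, Fin.val_eq_zero, add_zero]
  rfl

end Monomial

theorem counit_id_decomp_el (g : LieGen n r) :
    (counit.comp (SHom.id (LieD3 k))).map (decomp.map (el g 1)) = leftUnitorInv _ (el g 1) := by
  rw [decomp_el]
  refine (map_linComb _ _ _).trans ?_
  obtain rfl | h := eq_or_ne n 1
  · cases g
    rw [decompTerms, linComb_singleton, one_smul]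
    exact Monomial.counit_id_value_oneComp l1
  · have hred : linComb (fun x => (counit.comp (SHom.id (LieD3 k))).map (x.value k))
        (redTerms g) = 0 := linComb_eq_zero fun x hx =>
      Monomial.counit_id_value_eq_zero (redTerms_top_arity_ne_one g x hx)
    have hcompOne := Monomial.counit_id_value_eq_zero (k := k) (x := .compOne g) h
    simpa only [decompTerms_of_arity_ne_one g h, linComb_cons, linComb_append, linComb_nil,
      hred, hcompOne, one_smul, smul_zero, add_zero] using Monomial.counit_id_value_oneComp g

theorem id_counit_decomp_el (g : LieGen n r) :
    ((SHom.id (LieD3 k)).comp counit).map (decomp.map (el g 1)) = rightUnitorInv _ (el g 1) := by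
  rw [decomp_el]
  refine (map_linComb _ _ _).trans ?_
  obtain rfl | h := eq_or_ne n 1
  · cases g
    rw [decompTerms, linComb_singleton, one_smul]
    exact Monomial.id_counit_value_compOne l1
  · have hred : linComb (fun x => ((SHom.id (LieD3 k)).comp counit).map (x.value k))
        (redTerms g) = 0 := linComb_eq_zero fun x hx =>
      (redTerms_exists_bot_arity_ne_one g x hx).elim fun _ => Monomial.id_counit_value_eq_zero
    have honeComp :=
      Monomial.id_counit_value_eq_zero (k := k) (x := .oneComp g) (i := (0 : Fin 1)) h
    simpa only [decompTerms_of_arity_ne_one g h, linComb_cons, linComb_append, linComb_nil,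
      hred, honeComp, one_smul, smul_zero, zero_add, add_zero] using
      Monomial.id_counit_value_compOne g

theorem decomp_d_el (g : LieGen n r) :
    decomp.map ((LieD3 k).d (el g 1 : FreeX k n r)) = CompX.d (decomp.map (el g 1)) := by
  have hd : decomp.map ((LieD3 k).d (el g 1 : FreeX k n r)) =
      linComb (Corolla.value k (r - 1)) (diffDecomp g) := by
    rw [d_el, map_linComb, diffDecomp, linComb_bind]
    refine congrArg (linComb · _) (funext fun x => ?_)
    rw [linComb_bind, el_eq_act]
    refine (decomp.map_act _ _).trans ?_
    rw [decomp_el]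
    refine (map_linComb (CompX.act x.2) _ _).trans (congrArg (linComb · _) (funext fun y => ?_))
    rw [linComb_singleton, one_smul, y.value_act, Monomial.value_eq_value_tree]
  rw [hd, linComb_eq_of_sameTerms _ _ (sameTerms_diff g), linComb_bind, decomp_el, map_linComb]
  exact congrArg (linComb · _) (funext fun x => x.d_value.symm)

theorem coassoc_el (g : LieGen n r) :
    associator _ _ _ ((decomp.comp (SHom.id (LieD3 k))).map (decomp.map (el g 1))) =
      ((SHom.id (LieD3 k)).comp decomp).map (decomp.map (el g 1)) := by
  rw [decomp_el]
  calc _ = linComb (fun x => linComb (Corolla.value₃ k r) (Monomial.decompTop x))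
        (decompTerms g) :=
        (map_linComb (associator _ _ _ ∘ₗ (decomp.comp (SHom.id (LieD3 k))).map) _ _).trans
          (congrArg (linComb · _) (funext Monomial.associator_decomp_id_value))
    _ = linComb (fun x => linComb (Corolla.value₃ k r) (Monomial.decompBots x))
        (decompTerms g) := by
        rw [← linComb_bind, linComb_eq_of_sameTerms _ _ (sameTerms_coassoc g), linComb_bind]
    _ = _ := ((map_linComb _ _ _).trans
        (congrArg (linComb · _) (funext Monomial.id_decomp_value))).symm

end Generators

section Cooperad

variable {k : Type u} [CommRing k] {n : ℕ} {r : ℤ}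

theorem eq_of_eq_on_el {V : Type*} [AddCommGroup V] [Module k V] (T : Perm (Fin n) → V → V)
    {F G : (LieD3 k).X n r → V} (hF : IsLinearMap k F) (hG : IsLinearMap k G)
    (hFT : ∀ σ x, F ((LieD3 k).act σ x) = T σ (F x))
    (hGT : ∀ σ x, G ((LieD3 k).act σ x) = T σ (G x))
    (h : ∀ g, F (el g 1) = G (el g 1)) (x : (LieD3 k).X n r) : F x = G x := by
  suffices hFG : (hF.mk' F : FreeX k n r →ₗ[k] V) = hG.mk' G from LinearMap.congr_fun hFG x
  refine Finsupp.lhom_ext' fun ⟨g, σ⟩ => LinearMap.ext_ring ?_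
  change F (el g σ) = G (el g σ)
  rw [el_eq_act]
  exact (hFT σ _).trans ((congrArg (T σ) (h g)).trans (hGT σ _).symm)

theorem map_decomp_act {P Q : DGSMod k} (f : SHom (LieD3 k) P) (f' : SHom (LieD3 k) Q)
    (σ : Perm (Fin n)) (x : (LieD3 k).X n r) :
    (f.comp f').map (decomp.map ((LieD3 k).act σ x)) =
      CompX.act σ ((f.comp f').map (decomp.map x)) :=
  (congrArg (f.comp f').map (decomp.map_act σ x)).trans ((f.comp f').map_act σ _)

theorem decomp_map_d (x : (LieD3 k).X n r) :
    decomp.map ((LieD3 k).d x) = CompX.d (decomp.map x) :=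
  eq_of_eq_on_el (fun σ => CompX.act σ)
    (decomp.map ∘ₗ (LieD3 k).d).isLinear (CompX.d ∘ₗ decomp.map).isLinear
    (fun σ x => (congrArg decomp.map (freeD_act σ x)).trans (decomp.map_act σ _))
    (fun σ x => (congrArg CompX.d (decomp.map_act σ x)).trans (CompX.d_act σ _)) decomp_d_el x

theorem counit_map_d (x : (LieD3 k).X n r) : counit.map ((LieD3 k).d x) = 0 :=
  eq_of_eq_on_el (fun _ y => y) (counit.map ∘ₗ (LieD3 k).d).isLinear (0 : _ →ₗ[k] _).isLinear
    (fun σ x => (congrArg counit.map (freeD_act σ x)).trans (counit.map_act σ _))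
    (fun _ _ => rfl) counit_d_el x

theorem decomp_coassoc (x : (LieD3 k).X n r) :
    associator _ _ _ ((decomp.comp (SHom.id (LieD3 k))).map (decomp.map x)) =
      ((SHom.id (LieD3 k)).comp decomp).map (decomp.map x) :=
  eq_of_eq_on_el (fun σ => CompX.act σ)
    (associator _ _ _ ∘ₗ (decomp.comp (SHom.id (LieD3 k))).map ∘ₗ decomp.map).isLinear
    (((SHom.id (LieD3 k)).comp decomp).map ∘ₗ decomp.map).isLinear
    (fun σ x => (congrArg (associator _ _ _) (map_decomp_act _ _ σ x)).trans (associator_act σ _))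
    (map_decomp_act _ _) coassoc_el x

theorem counit_id_decomp (x : (LieD3 k).X n r) :
    (counit.comp (SHom.id (LieD3 k))).map (decomp.map x) = leftUnitorInv (LieD3 k) x :=
  eq_of_eq_on_el (fun σ => CompX.act σ)
    ((counit.comp (SHom.id (LieD3 k))).map ∘ₗ decomp.map).isLinear (isLinearMap_leftUnitorInv _)
    (map_decomp_act _ _) (leftUnitorInv_act _) counit_id_decomp_el x

theorem id_counit_decomp (x : (LieD3 k).X n r) :
    ((SHom.id (LieD3 k)).comp counit).map (decomp.map x) = rightUnitorInv (LieD3 k) x :=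
  eq_of_eq_on_el (fun σ => CompX.act σ)
    (((SHom.id (LieD3 k)).comp counit).map ∘ₗ decomp.map).isLinear (isLinearMap_rightUnitorInv _)
    (map_decomp_act _ _) (rightUnitorInv_act _) id_counit_decomp_el x

theorem isDGCooperad_LieD3 : IsDGCooperad (LieD3 k) decomp counit where
  decomp_d := decomp_map_d
  counit_d := counit_map_d
  coassoc := decomp_coassoc
  counit_left := counit_id_decomp
  counit_right := id_counit_decomp

theorem isSFree_LieD3 : IsSFree (LieD3 k) := fun n r =>
  ⟨LieGen n r, Finsupp.basisSingleOne, fun i σ τ => by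
    rw [Finsupp.coe_basisSingleOne]
    exact freeAct_el τ σ i⟩

end Cooperad

end DGSMod

theorem mainTheorem4 {k : Type u} [CommRing k] :
    DGSMod.IsSFree (DGSMod.LieD3 k) ∧
      DGSMod.IsDGCooperad (DGSMod.LieD3 k) DGSMod.LieD3.decomp DGSMod.LieD3.counit :=
  ⟨DGSMod.isSFree_LieD3, DGSMod.isDGCooperad_LieD3⟩
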